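/- For positive integers $d,n$ let $\Gamma_n^d$ be the set of $(0,1)$-matrices of order $n$ in which every row has exactly $d$ non-zero entries, and these form a contiguous block. Let $\operatorname{per}$ denote the permanent and put $$M_n^d=\{A\in\Gamma_n^d : \operatorname{per}(A)\ge\operatorname{per}(B)\text{ for all }B\in\Gamma_n^d\}.$$ Write $A\cong B$ if $B$ arises from $A$ by permuting rows and permuting columns, $\oplus$ for the direct sum of square matrices, $1_{d\times d}$ for the all-ones matrix of order $d$, $a1_{d\times d}$ for the direct sum of $a$ copies of it, and $\operatorname{ord}(C)$ for the order of $C$. For a $(0,1)$-matrix $C$ of order $m$, let $G(C)$ be the bipartite graph with one vertex per row and one per column of $C$, row $i$ being adjacent to column $j$ iff $c_{i,j}=1$. The matrices $C_1,\dots,C_k$ are the components of $A$ if $A\cong C_1\oplus\dots\oplus C_k$ and every $C_i$ is fully indecomposable, that is, non-zero and without a zero submatrix of size $s\times(\operatorname{ord}(C_i)-s)$ for $1\le s\le \operatorname{ord}(C_i)-1$. Let $b^*_d$ be the smallest non-negative integer $b$ such that for every $n$ and every $A\in M_n^d$, each component of $A$ that does not contain $1_{d\times d}$ as a submatrix has order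 at most $b$. **Theorem.** Let $d\le n$ be positive integers. The number $b^*_d$ exists, and every $A\in M_n^d$ is of the form $$A\cong a1_{d\times d}\oplus C_1\oplus C_2\oplus\dots\oplus C_h$$ with integers $a\ge 0$ and $0\le h\le d-1$, where for each $i$ the graph $G(C_i)$ is connected, $C_i\in M^d_{\operatorname{ord}(C_i)}$, and, if $C_i$ does not contain $1_{d\times d}$ as a submatrix, $\operatorname{ord}(C_i)\le b^*_d$. -/

import Mathlib

namespace OptimalAnticode

/-- `Γ_n^d`: the `(0,1)`-matrices of order `n` with exactly `d` non-zero entries in each row,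
which form a contiguous block (starting at the column `x`, which depends on the row). -/
def Gam (n d : ℕ) : Set (Matrix (Fin n) (Fin n) ℕ) :=
  {A | ∀ i, ∃ x : ℕ, x + d ≤ n ∧
    ∀ j : Fin n, A i j = if x ≤ (j : ℕ) ∧ (j : ℕ) < x + d then 1 else 0}

/-- `M_n^d`: the matrices of maximum permanent in `Γ_n^d`. -/
def Opt (n d : ℕ) : Set (Matrix (Fin n) (Fin n) ℕ) :=
  {A | A ∈ Gam n d ∧ ∀ B ∈ Gam n d, B.permanent ≤ A.permanent}

/-- Isomorphism of matrices: equality up to a permutation of the rows and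
a permutation of the columns. -/
def Iso {I J : Type*} (A : Matrix I I ℕ) (B : Matrix J J ℕ) : Prop :=
  ∃ e f : I ≃ J, B.submatrix e f = A

/-- The all-ones matrix `1_{d×d}`. -/
def allOnes (d : ℕ) : Matrix (Fin d) (Fin d) ℕ := Matrix.of fun _ _ => 1

/-- The matrix `A` contains `1_{d×d}` as a submatrix. -/
def ContainsOnes {I : Type*} (d : ℕ) (A : Matrix I I ℕ) : Prop :=
  ∃ r c : Fin d ↪ I, A.submatrix r c = allOnes d

/-- The bipartite graph `G(A)`: the vertices are the rows (`Sum.inl`) and the columns (`Sum.inr`),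
and row `i` is joined to column `j` iff `A i j = 1`. -/
def bipGraph {I : Type*} (A : Matrix I I ℕ) : SimpleGraph (I ⊕ I) :=
  SimpleGraph.fromRel fun v w => ∃ i j, v = Sum.inl i ∧ w = Sum.inr j ∧ A i j = 1

/-- Full indecomposability: the matrix is non-zero and, with `n` its order, it has no zero
submatrix of size `s × (n - s)` with `1 ≤ s ≤ n - 1`. (A matrix of order `1` is fully
indecomposable iff it is non-zero; the empty matrix is not.) -/
def FullyIndecomposable {n : ℕ} (A : Matrix (Fin n) (Fin n) ℕ) : Prop :=
  A ≠ 0 ∧ ∀ R C : Finset (Fin n), R.Nonempty → C.Nonempty → R.card + C.card = n →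
    ∃ i ∈ R, ∃ j ∈ C, A i j ≠ 0

/-- The matrices `C_1, …, C_k`, of orders `m_1, …, m_k`, are the components of `A`:
`A ≅ C_1 ⊕ ⋯ ⊕ C_k`, and each `C_i` is fully indecomposable. -/
def AreComponents {n k : ℕ} (A : Matrix (Fin n) (Fin n) ℕ) (m : Fin k → ℕ)
    (C : ∀ i, Matrix (Fin (m i)) (Fin (m i)) ℕ) : Prop :=
  Iso A (Matrix.blockDiagonal' C) ∧ ∀ i, FullyIndecomposable (C i)

/-- The numbers `b` such that, for every `n` and every `A ∈ M_n^d`, each component of `A` that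
does not contain `1_{d×d}` as a submatrix has order at most `b`. -/
def componentBounds (d : ℕ) : Set ℕ :=
  {b | ∀ (n : ℕ), ∀ A ∈ Opt n d, ∀ (k : ℕ) (m : Fin k → ℕ)
    (C : ∀ i, Matrix (Fin (m i)) (Fin (m i)) ℕ), AreComponents A m C →
      ∀ i, ¬ ContainsOnes d (C i) → m i ≤ b}

/-- `b*_d`: the smallest element of `componentBounds d`. -/
noncomputable def bStar (d : ℕ) : ℕ := sInf (componentBounds d)

/-- The direct sum `a 1_{d×d} ⊕ C_1 ⊕ ⋯ ⊕ C_h`. -/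
def onesSum (d a : ℕ) {h : ℕ} (m : Fin h → ℕ) (C : ∀ i, Matrix (Fin (m i)) (Fin (m i)) ℕ) :
    Matrix ((Fin d × Fin a) ⊕ (Σ i, Fin (m i))) ((Fin d × Fin a) ⊕ (Σ i, Fin (m i))) ℕ :=
  Matrix.fromBlocks (Matrix.blockDiagonal fun _ : Fin a => allOnes d) 0 0
    (Matrix.blockDiagonal' C)

end OptimalAnticode

namespace OptimalAnticode

open Finset

/-! ### Sequential counting of the elements of a finite set of functions -/

/-! After its rows are sorted, an optimal matrix is cut into consecutive diagonal blocks, each of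
them optimal and connected (`nonempty_decomposition`). Blocks of order `d` are all-ones. It remains
to see that at most `d - 1` blocks have another order, and that blocks without `1_{d×d}` have order
at most `b*_d`.

The main tool is the Bregman–Minc inequality `per(A)^d ≤ d!^n` for row sums `d`, proved by the
entropy method: a perfect matching is revealed row by row in a random order, and the columns still
available to each row are counted. A row is mixed in a matching if one of its columns is matched to
a row with a different block. Each such pair adds a fixed gain to the inequality
(`card_mul_log_card_add_mixedPairs_le`). A connected block of order `m ≠ d` has a mixed pair, so its
permanent satisfies `per^d < d!^m` (`count_pow_lt`). Among `d` such blocks some have a total order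
divisible by `d`; replacing these by all-ones blocks would raise the permanent
(`Decomposition.card_ne_le`).

A row with fewer than `d` copies is mixed in every matching, whereas the maximal permanent is at
least `d!^(n/d - 2)`. So the number of such rows is bounded in terms of `d` alone
(`card_rareRows_le`). All rows of a component without `1_{d×d}` are of this kind, hence `b*_d`
exists (`componentBounds_nonempty`).

Finally, `b*_d` concerns fully indecomposable components, while the cutting only gives connected
blocks. Exchange arguments close this gap: if the first `t` rows of an optimal sorted matrix lie in
the first `t` columns and a later row reaches into these columns, then either the permanent can be
raised or some row has `d` copies (`le_of_tight_prefix`). So a connected block without `1_{d×d}` is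
fully indecomposable (`fullyIndecomposable_of_noCut`). -/

/-- The number of values at `i` of the functions in `S` which agree with `f` on all the places
that precede `i` in the order `τ`. -/
def branching {n : ℕ} {α : Type*} [DecidableEq α] (S : Finset (Fin n → α))
    (τ : Equiv.Perm (Fin n)) (f : Fin n → α) (i : Fin n) : ℕ :=
  ((S.filter fun g => ∀ j, τ j < τ i → g j = f j).image fun g => g i).card

theorem branching_pos {n : ℕ} {α : Type*} [DecidableEq α] {S : Finset (Fin n → α)}
    (τ : Equiv.Perm (Fin n)) {f : Fin n → α} (hf : f ∈ S) (i : Fin n) :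
    0 < branching S τ f i := by
  rw [branching, card_pos]
  exact ⟨f i, mem_image.2 ⟨f, by simp [hf], rfl⟩⟩

/-- Choose the values one by one in the order `τ`, each uniformly among those that still extend to
an element of `S`. The product is the probability of `g` given its first `k` choices. The induction
is on the number `r` of choices left. -/
theorem sum_prod_inv_branching_of_agree {n : ℕ} {α : Type*} [DecidableEq α]
    (S : Finset (Fin n → α)) (τ : Equiv.Perm (Fin n)) (r k : ℕ) (hk : k + r = n)
    (f : Fin n → α) (hf : f ∈ S) :
    ∑ g ∈ S with (∀ j, (τ j : ℕ) < k → g j = f j),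
      ∏ i with k ≤ (τ i : ℕ), ((branching S τ g i : ℝ))⁻¹ = 1 := by
  induction r generalizing k f with
  | zero =>
    have h1 : (S.filter fun g => ∀ j, (τ j : ℕ) < k → g j = f j) = {f} := by
      ext g
      simp only [mem_filter, mem_singleton]
      constructor
      · rintro ⟨-, h⟩
        funext j
        exact h j (by have := (τ j).2; omega)
      · rintro rfl
        exact ⟨hf, fun _ _ => rfl⟩
    have h2 : (univ.filter fun i => k ≤ (τ i : ℕ)) = ∅ := by
      ext i
      have := (τ i).2
      simp
      omega
    rw [h1, sum_singleton, h2, prod_empty]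
  | succ r ih =>
    have hkn : k < n := by omega
    set i₀ : Fin n := τ.symm ⟨k, hkn⟩ with hi₀
    have hτ : τ i₀ = ⟨k, hkn⟩ := by simp [hi₀]
    have hτk : (τ i₀ : ℕ) = k := by rw [hτ]
    set T := S.filter fun g => ∀ j, (τ j : ℕ) < k → g j = f j with hT
    have hbr : ∀ g ∈ T, branching S τ g i₀ = (T.image fun g => g i₀).card := by
      intro g hg
      rw [branching]
      congr 2
      ext g'
      simp only [hT, mem_filter] at hg ⊢
      refine and_congr_right fun _ => forall_congr' fun j => ?_
      rw [Fin.lt_def, hτk]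
      refine imp_congr_right fun hj => ?_
      rw [hg.2 j hj]
    have hV : 0 < (T.image fun g => g i₀).card :=
      card_pos.2 ⟨f i₀, mem_image.2 ⟨f, by simp [hT, hf], rfl⟩⟩
    rw [← sum_fiberwise_of_maps_to (t := T.image fun g => g i₀) (g := fun g => g i₀)
      (fun g hg => mem_image_of_mem _ hg)]
    have hfib : ∀ v ∈ T.image (fun g => g i₀),
        ∑ g ∈ T with g i₀ = v, ∏ i with k ≤ (τ i : ℕ), ((branching S τ g i : ℝ))⁻¹ =
          ((T.image fun g => g i₀).card : ℝ)⁻¹ := by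
      intro v hv
      obtain ⟨f', hf', rfl⟩ := mem_image.1 hv
      have hf'' := hf'
      simp only [hT, mem_filter] at hf''
      have hset : (T.filter fun g => g i₀ = f' i₀) =
          S.filter fun g => ∀ j, (τ j : ℕ) < k + 1 → g j = f' j := by
        ext g
        simp only [hT, mem_filter]
        constructor
        · rintro ⟨⟨h1, h2⟩, h3⟩
          refine ⟨h1, fun j hj => ?_⟩
          rcases Nat.lt_succ_iff_lt_or_eq.1 hj with hj | hj
          · rw [h2 j hj, hf''.2 j hj]
          · have : j = i₀ := τ.injective (Fin.ext (by rw [hj, hτk]))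
            rw [this, h3]
        · rintro ⟨h1, h2⟩
          refine ⟨⟨h1, fun j hj => ?_⟩, h2 i₀ (by omega)⟩
          rw [h2 j (by omega), hf''.2 j hj]
      have hidx : (univ.filter fun i => k ≤ (τ i : ℕ)) =
          insert i₀ (univ.filter fun i => k + 1 ≤ (τ i : ℕ)) := by
        ext i
        simp only [mem_filter, mem_univ, true_and, mem_insert]
        constructor
        · intro h
          rcases Nat.eq_or_lt_of_le h with h | h
          · left
            exact τ.injective (Fin.ext (by rw [← h, hτk]))
          · right
            exact h
        · rintro (rfl | h)
          · omega
          · omega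
      have hnot : i₀ ∉ univ.filter fun i => k + 1 ≤ (τ i : ℕ) := by
        simp [hτk]
      calc ∑ g ∈ T with g i₀ = f' i₀, ∏ i with k ≤ (τ i : ℕ), ((branching S τ g i : ℝ))⁻¹
          = ∑ g ∈ T with g i₀ = f' i₀, ((T.image fun g => g i₀).card : ℝ)⁻¹ *
              ∏ i with k + 1 ≤ (τ i : ℕ), ((branching S τ g i : ℝ))⁻¹ := by
            refine sum_congr rfl fun g hg => ?_
            rw [hidx, prod_insert hnot, hbr g (mem_filter.1 hg).1]
        _ = ((T.image fun g => g i₀).card : ℝ)⁻¹ := by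
            rw [← mul_sum, hset, ih (k + 1) (by omega) f' hf''.1, mul_one]
    rw [sum_congr rfl hfib, sum_const, nsmul_eq_mul]
    exact mul_inv_cancel₀ (by exact_mod_cast hV.ne')

/-- Gibbs' inequality for the uniform distribution on `S` and the sequential one: `log z ≤ z - 1` is
applied to `|S|` times the sequential probability of `f`, and the right-hand sides sum to zero. -/
theorem card_mul_log_card_le {n : ℕ} {α : Type*} [DecidableEq α]
    (S : Finset (Fin n → α)) (τ : Equiv.Perm (Fin n)) :
    (S.card : ℝ) * Real.log S.card ≤ ∑ f ∈ S, ∑ i, Real.log (branching S τ f i) := by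
  rcases S.eq_empty_or_nonempty with rfl | ⟨f₀, hf₀⟩
  · simp
  have hS : (0 : ℝ) < S.card := by exact_mod_cast card_pos.2 ⟨f₀, hf₀⟩
  have hsum : ∑ f ∈ S, ∏ i, ((branching S τ f i : ℝ))⁻¹ = 1 := by
    have := sum_prod_inv_branching_of_agree S τ n 0 (by simp) f₀ hf₀
    simpa using this
  have hterm : ∀ f ∈ S, Real.log S.card - ∑ i, Real.log (branching S τ f i) ≤
      S.card * ∏ i, ((branching S τ f i : ℝ))⁻¹ - 1 := by
    intro f hf
    have hpos : ∀ i, (0 : ℝ) < (branching S τ f i : ℝ) := fun i => by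
      exact_mod_cast branching_pos τ hf i
    have hprod : 0 < ∏ i, ((branching S τ f i : ℝ))⁻¹ :=
      prod_pos fun i _ => inv_pos.2 (hpos i)
    have := Real.log_le_sub_one_of_pos (mul_pos hS hprod)
    rw [Real.log_mul hS.ne' hprod.ne', Real.log_prod (fun i _ => (inv_pos.2 (hpos i)).ne')] at this
    simpa [Real.log_inv, sub_eq_add_neg] using this
  have := sum_le_sum hterm
  rw [sum_sub_distrib, sum_sub_distrib, ← mul_sum, hsum] at this
  simp only [sum_const, nsmul_eq_mul] at this
  linarith

/-! ### Uniformly random orders -/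

/-- Counted from the end of the order `τ`, the elements of `K` occupy the positions `1, …, |K|`,
each once. -/
theorem sum_rank {n : ℕ} (τ : Equiv.Perm (Fin n)) (K : Finset (Fin n)) (φ : ℕ → ℝ) :
    ∑ i ∈ K, φ (K.filter fun j => τ i ≤ τ j).card = ∑ j ∈ range K.card, φ (j + 1) := by
  induction hc : K.card generalizing K with
  | zero => simp [card_eq_zero.1 hc]
  | succ c ih =>
    have hne : K.Nonempty := card_pos.1 (by omega)
    obtain ⟨i₀, hi₀, hmin⟩ := exists_min_image K (fun i => τ i) hne
    have hrank : (K.filter fun j => τ i₀ ≤ τ j) = K := filter_true_of_mem hmin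
    rw [← add_sum_erase K _ hi₀, hrank, hc, sum_range_succ, add_comm]
    congr 1
    rw [← ih (K.erase i₀) (by rw [card_erase_of_mem hi₀, hc]; rfl)]
    refine sum_congr rfl fun i hi => ?_
    congr 2
    ext j
    simp only [mem_filter, mem_erase]
    constructor
    · rintro ⟨h1, h2⟩
      refine ⟨⟨?_, h1⟩, h2⟩
      rintro rfl
      exact (mem_erase.1 hi).1 (τ.injective (le_antisymm h2 (hmin i (mem_erase.1 hi).2)))
    · rintro ⟨⟨-, h1⟩, h2⟩
      exact ⟨h1, h2⟩

theorem sum_perm_rank_eq {n : ℕ} (K : Finset (Fin n)) (φ : ℕ → ℝ) {i k : Fin n} (hi : i ∈ K)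
    (hk : k ∈ K) :
    ∑ τ : Equiv.Perm (Fin n), φ (K.filter fun j => τ i ≤ τ j).card =
      ∑ τ : Equiv.Perm (Fin n), φ (K.filter fun j => τ k ≤ τ j).card := by
  refine Fintype.sum_equiv (Equiv.mulRight (Equiv.swap i k)) _ _ fun τ => ?_
  congr 1
  refine card_bij (fun j _ => Equiv.swap i k j) ?_ ?_ ?_
  · intro j hj
    simp only [mem_filter, Equiv.coe_mulRight, Equiv.Perm.mul_apply, Equiv.swap_apply_right,
      Equiv.swap_apply_self] at hj ⊢
    refine ⟨?_, hj.2⟩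
    by_cases h1 : j = i
    · subst h1; simpa using hk
    by_cases h2 : j = k
    · subst h2; simpa using hi
    rw [Equiv.swap_apply_of_ne_of_ne h1 h2]
    exact hj.1
  · intro a _ b _ h
    exact (Equiv.swap i k).injective h
  · intro j hj
    refine ⟨Equiv.swap i k j, ?_, by simp⟩
    simp only [mem_filter, Equiv.coe_mulRight, Equiv.Perm.mul_apply, Equiv.swap_apply_right] at hj ⊢
    refine ⟨?_, hj.2⟩
    by_cases h1 : j = i
    · subst h1; simpa using hk
    by_cases h2 : j = k
    · subst h2; simpa using hi
    rw [Equiv.swap_apply_of_ne_of_ne h1 h2]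
    exact hj.1

/-- In a random order the position of `i` within `K` is uniform on `1, …, |K|`, as transpositions
show. -/
theorem card_mul_sum_log_rank {n : ℕ} (K : Finset (Fin n)) {i : Fin n} (hi : i ∈ K) :
    (K.card : ℝ) * ∑ τ : Equiv.Perm (Fin n), Real.log (K.filter fun j => τ i ≤ τ j).card =
      n.factorial * Real.log K.card.factorial := by
  have h1 : (K.card : ℝ) * ∑ τ : Equiv.Perm (Fin n),
      Real.log (K.filter fun j => τ i ≤ τ j).card =
      ∑ k ∈ K, ∑ τ : Equiv.Perm (Fin n), Real.log (K.filter fun j => τ k ≤ τ j).card := by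
    rw [sum_congr rfl fun k hk => (sum_perm_rank_eq K (fun m => Real.log m) hk hi), sum_const,
      nsmul_eq_mul]
  rw [h1, sum_comm]
  have h2 : ∀ τ : Equiv.Perm (Fin n),
      ∑ k ∈ K, Real.log (K.filter fun j => τ k ≤ τ j).card = Real.log K.card.factorial := by
    intro τ
    rw [sum_rank τ K fun m => Real.log m, ← prod_range_add_one_eq_factorial, Nat.cast_prod,
      Real.log_prod (fun j _ => by positivity)]
  rw [sum_congr rfl fun τ _ => h2 τ, sum_const, nsmul_eq_mul, card_univ, Fintype.card_perm,
    Fintype.card_fin]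

/-- The orders in which `b` is the last element of `X` and `a` the last but one. -/
def lastTwo {n : ℕ} (X : Finset (Fin n)) (a b : Fin n) : Finset (Equiv.Perm (Fin n)) :=
  univ.filter fun τ => τ a < τ b ∧ ∀ k ∈ X, k ≠ a → k ≠ b → τ k < τ a

/-- Swap the last element of `X` with `b`, then the last but one with `a`: any order lands in
`lastTwo`. The two displaced elements allow it to be recovered, which costs the factor `|X|^2`. -/
theorem factorial_le_mul_card_lastTwo {n : ℕ} (X : Finset (Fin n)) {a b : Fin n} (ha : a ∈ X)
    (hb : b ∈ X) (hab : a ≠ b) :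
    n.factorial ≤ X.card ^ 2 * (lastTwo X a b).card := by
  classical
  have hcover : (univ : Finset (Equiv.Perm (Fin n))) ⊆
      ((X ×ˢ X) ×ˢ lastTwo X a b).image fun p =>
        p.2 * Equiv.swap p.1.2 a * Equiv.swap p.1.1 b := by
    intro τ _
    obtain ⟨b', hb', hmax⟩ := exists_max_image X (fun i => τ i) ⟨a, ha⟩
    set τ₁ := τ * Equiv.swap b' b with hτ₁
    have hmem : ∀ u ∈ X, ∀ v ∈ X, ∀ k ∈ X, Equiv.swap u v k ∈ X := by
      intro u hu v hv k hk
      rcases Equiv.swap_apply_def u v k with h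
      rw [h]
      split_ifs <;> assumption
    have hτ₁b : ∀ k ∈ X, τ₁ k ≤ τ₁ b := by
      intro k hk
      simp only [hτ₁, Equiv.Perm.mul_apply, Equiv.swap_apply_right]
      exact hmax _ (hmem b' hb' b hb k hk)
    obtain ⟨a', ha', hmax'⟩ := exists_max_image (X.erase b) (fun i => τ₁ i)
      ⟨a, mem_erase.2 ⟨hab, ha⟩⟩
    rw [mem_erase] at ha'
    set τ₂ := τ₁ * Equiv.swap a' a with hτ₂
    have hb₂ : τ₂ b = τ₁ b := by
      rw [hτ₂, Equiv.Perm.mul_apply, Equiv.swap_apply_of_ne_of_ne ha'.1.symm hab.symm]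
    have ha₂ : τ₂ a = τ₁ a' := by
      rw [hτ₂, Equiv.Perm.mul_apply, Equiv.swap_apply_right]
    refine mem_image.2 ⟨((b', a'), τ₂), ?_, ?_⟩
    · simp only [mem_product, lastTwo, mem_filter, mem_univ, true_and]
      refine ⟨⟨hb', ha'.2⟩, ?_, ?_⟩
      · rw [hb₂, ha₂]
        exact lt_of_le_of_ne (hτ₁b a' ha'.2) fun h => ha'.1 (τ₁.injective h)
      · intro k hk hka hkb
        rw [ha₂]
        have hk' : Equiv.swap a' a k ∈ X.erase b := by
          refine mem_erase.2 ⟨?_, hmem a' ha'.2 a ha k hk⟩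
          intro h
          apply hkb
          rw [Equiv.swap_apply_eq_iff] at h
          rwa [Equiv.swap_apply_of_ne_of_ne ha'.1.symm hab.symm] at h
        refine lt_of_le_of_ne (hmax' _ hk') fun h => hka ?_
        have := τ₁.injective h
        rw [Equiv.swap_apply_eq_iff] at this
        simpa using this
    · simp [hτ₂, hτ₁, mul_assoc]
  have := (card_le_card hcover).trans card_image_le
  rw [card_univ, Fintype.card_perm, Fintype.card_fin, card_product, card_product] at this
  rw [sq]
  exact this

/-! ### A refinement of the Bregman–Minc inequality -/

/-- The perfect matchings of the bipartite graph in which row `i` is joined to the columns in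
`N i`. -/
def matchings {n : ℕ} (N : Fin n → Finset (Fin n)) : Finset (Equiv.Perm (Fin n)) :=
  univ.filter fun σ => ∀ i, σ i ∈ N i

theorem mem_matchings {n : ℕ} {N : Fin n → Finset (Fin n)} {σ : Equiv.Perm (Fin n)} :
    σ ∈ matchings N ↔ ∀ i, σ i ∈ N i := by
  simp [matchings]

/-- The matchings as functions. -/
def matchingFuns {n : ℕ} (N : Fin n → Finset (Fin n)) : Finset (Fin n → Fin n) :=
  (matchings N).map ⟨fun σ : Equiv.Perm (Fin n) => ⇑σ, DFunLike.coe_injective⟩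

/-- The rows that are matched by `σ` to a column of row `i`. -/
def partners {n : ℕ} (N : Fin n → Finset (Fin n)) (σ : Equiv.Perm (Fin n)) (i : Fin n) :
    Finset (Fin n) :=
  univ.filter fun j => σ j ∈ N i

theorem card_partners {n : ℕ} (N : Fin n → Finset (Fin n)) (σ : Equiv.Perm (Fin n)) (i : Fin n) :
    (partners N σ i).card = (N i).card := by
  have : partners N σ i = (N i).map σ.symm.toEmbedding := by
    ext j
    simp [partners]
  rw [this, card_map]

/-- Columns that `σ` gives to rows before `i` are already taken when row `i` chooses. -/
theorem image_branching_subset {n : ℕ} {N : Fin n → Finset (Fin n)} {σ : Equiv.Perm (Fin n)}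
    (τ : Equiv.Perm (Fin n)) (i : Fin n) :
    (((matchingFuns N).filter fun g => ∀ j, τ j < τ i → g j = σ j).image fun g => g i) ⊆
      ((partners N σ i).filter fun j => τ i ≤ τ j).image σ := by
  intro c hc
  simp only [mem_image, mem_filter, matchingFuns, mem_map, Function.Embedding.coeFn_mk,
    partners, mem_univ, true_and] at hc ⊢
  obtain ⟨_, ⟨⟨ρ, hρ, rfl⟩, hag⟩, rfl⟩ := hc
  rw [mem_matchings] at hρ
  refine ⟨σ.symm (ρ i), ⟨by simpa using hρ i, ?_⟩, by simp⟩
  by_contra hlt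
  rw [not_le] at hlt
  have h := hag _ hlt
  rw [Equiv.apply_symm_apply] at h
  rw [ρ.injective h] at hlt
  exact lt_irrefl _ hlt

theorem branching_le_card {n : ℕ} {N : Fin n → Finset (Fin n)} {σ : Equiv.Perm (Fin n)}
    (τ : Equiv.Perm (Fin n)) (i : Fin n) :
    branching (matchingFuns N) τ σ i ≤ ((partners N σ i).filter fun j => τ i ≤ τ j).card :=
  (card_le_card (image_branching_subset τ i)).trans card_image_le

/-- When row `i` chooses, all columns of row `k` except `σ k` are taken. So every continuation gives
`σ k` to row `k`, and this column, though free, is lost to row `i`. -/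
theorem branching_lt_card {n : ℕ} {N : Fin n → Finset (Fin n)} {σ : Equiv.Perm (Fin n)}
    {τ : Equiv.Perm (Fin n)} {i k : Fin n} (hk : σ k ∈ N i) (hik : τ i < τ k)
    (hlast : ∀ j, σ j ∈ N k → j ≠ k → τ j < τ i) :
    branching (matchingFuns N) τ σ i < ((partners N σ i).filter fun j => τ i ≤ τ j).card := by
  have hsub := image_branching_subset (N := N) (σ := σ) τ i
  have hlt : (((matchingFuns N).filter fun g => ∀ j, τ j < τ i → g j = σ j).image fun g => g i) ⊂
      ((partners N σ i).filter fun j => τ i ≤ τ j).image σ := by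
    refine (ssubset_iff_of_subset hsub).2 ⟨σ k, ?_, ?_⟩
    · exact mem_image_of_mem _ (by simp [partners, hk, hik.le])
    · intro hc
      simp only [mem_image, mem_filter, matchingFuns, mem_map, Function.Embedding.coeFn_mk] at hc
      obtain ⟨_, ⟨⟨ρ, hρ, rfl⟩, hag⟩, hρi⟩ := hc
      rw [mem_matchings] at hρ
      by_cases hj : σ.symm (ρ k) = k
      · rw [Equiv.symm_apply_eq, ← hρi] at hj
        rw [ρ.injective hj] at hik
        exact lt_irrefl _ hik
      · have h := hag _ (hlast (σ.symm (ρ k)) (by simpa using hρ k) hj)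
        rw [Equiv.apply_symm_apply] at h
        exact hj (ρ.injective h)
  exact (card_lt_card hlt).trans_le card_image_le

/-- Row `i` can take the column of some row `k` which cannot take the column of row `i`. -/
def Bad {n : ℕ} (N : Fin n → Finset (Fin n)) (σ : Equiv.Perm (Fin n)) (i : Fin n) : Prop :=
  ∃ k, σ k ∈ N i ∧ σ i ∉ N k

instance {n : ℕ} (N : Fin n → Finset (Fin n)) (σ : Equiv.Perm (Fin n)) (i : Fin n) :
    Decidable (Bad N σ i) :=
  inferInstanceAs (Decidable (∃ k, σ k ∈ N i ∧ σ i ∉ N k))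

theorem log_add_inv_le_log {a b d : ℕ} (ha : 0 < a) (hab : a < b) (hbd : b ≤ d) :
    Real.log a + (d : ℝ)⁻¹ ≤ Real.log b := by
  have ha' : (0 : ℝ) < a := by exact_mod_cast ha
  have hb' : (0 : ℝ) < b := by exact_mod_cast ha.trans hab
  have h1 : Real.log (a / b) ≤ a / b - 1 := Real.log_le_sub_one_of_pos (by positivity)
  rw [Real.log_div ha'.ne' hb'.ne'] at h1
  have h2 : (a : ℝ) + 1 ≤ b := by exact_mod_cast hab
  have h3 : (a : ℝ) / b - 1 ≤ -(b : ℝ)⁻¹ := by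
    rw [div_sub_one hb'.ne', neg_eq_neg_one_mul, ← div_eq_mul_inv]
    exact div_le_div_of_nonneg_right (by linarith) hb'.le
  have h4 : (d : ℝ)⁻¹ ≤ (b : ℝ)⁻¹ := inv_anti₀ hb' (by exact_mod_cast hbd)
  linarith

theorem sum_log_branching_le {n d : ℕ} (hd : 0 < d) {N : Fin n → Finset (Fin n)}
    (hN : ∀ i, (N i).card = d) {σ : Equiv.Perm (Fin n)} (hσ : σ ∈ matchings N) (i : Fin n) :
    ∑ τ : Equiv.Perm (Fin n), Real.log (branching (matchingFuns N) τ σ i) +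
      (if Bad N σ i then (n.factorial : ℝ) / (d * (d + 1) ^ 2) else 0) ≤
      n.factorial / d * Real.log d.factorial := by
  have hd' : (0 : ℝ) < d := by exact_mod_cast hd
  have hσ' := mem_matchings.1 hσ
  have hmemS : ⇑σ ∈ matchingFuns N := by
    simp only [matchingFuns, mem_map, Function.Embedding.coeFn_mk]
    exact ⟨σ, hσ, rfl⟩
  have hpart : ∀ k, (partners N σ k).card = d := fun k => (card_partners N σ k).trans (hN k)
  have havg := card_mul_sum_log_rank (partners N σ i) (i := i) (by simp [partners, hσ' i])
  rw [hpart] at havg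
  have hrhs : n.factorial / d * Real.log d.factorial =
      ∑ τ : Equiv.Perm (Fin n),
        Real.log ((partners N σ i).filter fun j => τ i ≤ τ j).card := by
    rw [div_mul_eq_mul_div, ← havg, mul_div_cancel_left₀ _ hd'.ne']
  rw [hrhs]
  have hle : ∀ τ : Equiv.Perm (Fin n), Real.log (branching (matchingFuns N) τ σ i) ≤
      Real.log ((partners N σ i).filter fun j => τ i ≤ τ j).card := fun τ =>
    Real.log_le_log (by exact_mod_cast branching_pos τ hmemS i)
      (by exact_mod_cast branching_le_card τ i)
  split_ifs with hbad
  · obtain ⟨k, hk, hik⟩ := hbad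
    have hne : i ≠ k := by
      rintro rfl
      exact hik (hσ' i)
    -- Row `i` is not among the `d` partners of `k`. Whenever `i` and `k` come last in this order
    -- among these `d + 1` rows, row `i` loses one of at most `d` options, which saves at least `1 /
    -- d` in the logarithm.
    have hX : (insert i (partners N σ k)).card = d + 1 := by
      rw [card_insert_of_notMem (by simpa [partners] using hik), hpart]
    have hcount := factorial_le_mul_card_lastTwo (insert i (partners N σ k)) (a := i) (b := k)
      (mem_insert_self _ _) (mem_insert_of_mem (by simp [partners, hσ' k])) hne
    rw [hX] at hcount
    have hterm : ∀ τ : Equiv.Perm (Fin n), Real.log (branching (matchingFuns N) τ σ i) +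
        (if τ ∈ lastTwo (insert i (partners N σ k)) i k then (d : ℝ)⁻¹ else 0) ≤
        Real.log ((partners N σ i).filter fun j => τ i ≤ τ j).card := by
      intro τ
      split_ifs with hτ
      · simp only [lastTwo, mem_filter, mem_univ, true_and] at hτ
        refine log_add_inv_le_log (branching_pos τ hmemS i) (branching_lt_card hk hτ.1 ?_)
          ((card_filter_le _ _).trans (hpart i).le)
        intro j hj hjk
        refine hτ.2 j (mem_insert_of_mem (by simp [partners, hj])) ?_ hjk
        rintro rfl
        exact hik hj
      · rw [add_zero]
        exact hle τ
    have hsum := sum_le_sum fun τ (_ : τ ∈ univ) => hterm τ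
    rw [sum_add_distrib, ← sum_filter, filter_mem_eq_inter, univ_inter, sum_const,
      nsmul_eq_mul] at hsum
    refine le_trans (add_le_add_right ?_ _) hsum
    have hcount' : (n.factorial : ℝ) ≤
        ((d : ℝ) + 1) ^ 2 * (lastTwo (insert i (partners N σ k)) i k).card := by
      exact_mod_cast hcount
    rw [div_le_iff₀ (by positivity)]
    calc (n.factorial : ℝ) ≤
        ((d : ℝ) + 1) ^ 2 * (lastTwo (insert i (partners N σ k)) i k).card := hcount'
      _ = _ := by field_simp
  · rw [add_zero]
    exact sum_le_sum fun τ _ => hle τ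

/-- The pairs of a matching and a row that is bad for it. -/
def badPairs {n : ℕ} (N : Fin n → Finset (Fin n)) : Finset (Equiv.Perm (Fin n) × Fin n) :=
  (matchings N ×ˢ univ).filter fun p => Bad N p.1 p.2

theorem card_mul_log_card_add_badPairs_le {n d : ℕ} (hd : 0 < d) {N : Fin n → Finset (Fin n)}
    (hN : ∀ i, (N i).card = d) :
    ((matchings N).card : ℝ) * Real.log (matchings N).card +
        (badPairs N).card / (d * (d + 1) ^ 2) ≤
      (matchings N).card * (n / d * Real.log d.factorial) := by
  have hfac : (0 : ℝ) < n.factorial := by exact_mod_cast n.factorial_pos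
  have hcardS : (matchingFuns N).card = (matchings N).card := card_map _
  have h1 : ∀ τ : Equiv.Perm (Fin n), ((matchings N).card : ℝ) * Real.log (matchings N).card ≤
      ∑ σ ∈ matchings N, ∑ i, Real.log (branching (matchingFuns N) τ σ i) := by
    intro τ
    have := card_mul_log_card_le (matchingFuns N) τ
    rw [hcardS] at this
    refine this.trans (le_of_eq ?_)
    rw [matchingFuns, sum_map]
    rfl
  have h2 := sum_le_sum fun τ (_ : τ ∈ (univ : Finset (Equiv.Perm (Fin n)))) => h1 τ
  rw [sum_const, nsmul_eq_mul, card_univ, Fintype.card_perm, Fintype.card_fin, sum_comm] at h2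
  have h3 : ∀ σ ∈ matchings N, ∑ τ : Equiv.Perm (Fin n), ∑ i,
      Real.log (branching (matchingFuns N) τ σ i) +
        ∑ i, (if Bad N σ i then (n.factorial : ℝ) / (d * (d + 1) ^ 2) else 0) ≤
      n * (n.factorial / d * Real.log d.factorial) := by
    intro σ hσ
    rw [sum_comm, ← sum_add_distrib]
    refine (sum_le_sum fun i _ => sum_log_branching_le hd hN hσ i).trans ?_
    simp
  have h4 := sum_le_sum h3
  rw [sum_add_distrib, sum_const, nsmul_eq_mul] at h4
  have h5 : ∑ σ ∈ matchings N, ∑ i,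
      (if Bad N σ i then (n.factorial : ℝ) / (d * (d + 1) ^ 2) else 0) =
      (badPairs N).card * ((n.factorial : ℝ) / (d * (d + 1) ^ 2)) := by
    rw [← sum_product', ← sum_filter, sum_const, nsmul_eq_mul]
    rfl
  rw [h5] at h4
  refine le_of_mul_le_mul_left ?_ hfac
  calc _ = n.factorial * ((matchings N).card * Real.log (matchings N).card) +
        (badPairs N).card * ((n.factorial : ℝ) / (d * (d + 1) ^ 2)) := by ring
    _ ≤ (matchings N).card * (n * (n.factorial / d * Real.log d.factorial)) := by linarith
    _ = _ := by ring

/-- Some row matched to a column of row `i` differs from row `i`. -/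
def Mixed {n : ℕ} (N : Fin n → Finset (Fin n)) (σ : Equiv.Perm (Fin n)) (i : Fin n) : Prop :=
  ∃ k, σ k ∈ N i ∧ N k ≠ N i

instance {n : ℕ} (N : Fin n → Finset (Fin n)) (σ : Equiv.Perm (Fin n)) (i : Fin n) :
    Decidable (Mixed N σ i) :=
  inferInstanceAs (Decidable (∃ k, σ k ∈ N i ∧ N k ≠ N i))

/-- The pairs of a matching and a row that is mixed for it. -/
def mixedPairs {n : ℕ} (N : Fin n → Finset (Fin n)) : Finset (Equiv.Perm (Fin n) × Fin n) :=
  (matchings N ×ˢ univ).filter fun p => Mixed N p.1 p.2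

/-- Let `k` be a partner of `i` with `N k ≠ N i`. If `i` is not bad, `i` and `k` can exchange
columns. By equal sizes some column `σ l` of `i` is not in `N k`. If `σ k ∉ N l`, then `l` makes `i`
bad after the exchange; if `σ k ∈ N l`, then `k` makes `l` bad for `σ`. -/
theorem Mixed.bad_or {n d : ℕ} {N : Fin n → Finset (Fin n)} (hN : ∀ i, (N i).card = d)
    {σ : Equiv.Perm (Fin n)} (hσ : σ ∈ matchings N) {i : Fin n} (h : Mixed N σ i) :
    Bad N σ i ∨ (∃ k, σ k ∈ N i ∧ Bad N σ k) ∨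
      ∃ k, σ * Equiv.swap i k ∈ matchings N ∧ Bad N (σ * Equiv.swap i k) i := by
  rw [mem_matchings] at hσ
  by_contra hcon
  push Not at hcon
  obtain ⟨hi, hpart, hswap⟩ := hcon
  simp only [Bad, not_exists, not_and, not_not] at hi hpart
  obtain ⟨k, hk, hne⟩ := h
  have hik : i ≠ k := by
    rintro rfl
    exact hne rfl
  have hmem : σ * Equiv.swap i k ∈ matchings N := by
    rw [mem_matchings]
    intro j
    rw [Equiv.Perm.mul_apply]
    by_cases h1 : j = i
    · subst h1; simpa using hk
    by_cases h2 : j = k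
    · subst h2; simpa using hi _ hk
    rw [Equiv.swap_apply_of_ne_of_ne h1 h2]
    exact hσ j
  refine hswap k hmem ?_
  have hns : ¬ N i ⊆ N k := fun hs => hne (eq_of_subset_of_card_le hs (by rw [hN, hN])).symm
  obtain ⟨c, hci, hck⟩ := not_subset.1 hns
  obtain ⟨l, rfl⟩ := σ.surjective c
  have hli : l ≠ i := by
    rintro rfl
    exact hck (hi k hk)
  have hlk : l ≠ k := by
    rintro rfl
    exact hck (hσ l)
  refine ⟨l, ?_, ?_⟩
  · rw [Equiv.Perm.mul_apply, Equiv.swap_apply_of_ne_of_ne hli hlk]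
    exact hci
  · rw [Equiv.Perm.mul_apply, Equiv.swap_apply_left]
    intro hkl
    exact hck (hpart l hci k hkl)

/-- Each case of `Mixed.bad_or` leads from a mixed pair to a bad pair. To go back, the first needs
no choice, and the other two a choice of a row through a known column, at most `D` ways each. -/
theorem card_mixedPairs_le {n d D : ℕ} {N : Fin n → Finset (Fin n)} (hN : ∀ i, (N i).card = d)
    (hD : ∀ c, (univ.filter fun i => c ∈ N i).card ≤ D) :
    (mixedPairs N).card ≤ (1 + 2 * D) * (badPairs N).card := by
  classical
  have hsub : mixedPairs N ⊆ badPairs N ∪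
      (((badPairs N).biUnion fun p =>
        (univ.filter fun i => p.1 p.2 ∈ N i).image fun i => (p.1, i)) ∪
      ((badPairs N).biUnion fun p =>
        (univ.filter fun k => p.1 p.2 ∈ N k).image
          fun k => (p.1 * Equiv.swap p.2 k, p.2))) := by
    rintro ⟨σ, i⟩ hp
    simp only [mixedPairs, mem_filter, mem_product, mem_univ, and_true] at hp
    simp only [mem_union, mem_biUnion, mem_image, badPairs, mem_filter, mem_product, mem_univ,
      and_true, true_and, Prod.exists, Prod.mk.injEq]
    rcases hp.2.bad_or hN hp.1 with h | ⟨k, hk, h⟩ | ⟨k, hmem, h⟩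
    · exact Or.inl ⟨hp.1, h⟩
    · exact Or.inr (Or.inl ⟨σ, k, ⟨hp.1, h⟩, i, hk, rfl, rfl⟩)
    · refine Or.inr (Or.inr ⟨σ * Equiv.swap i k, i, ⟨hmem, h⟩, k, ?_, by simp [mul_assoc], rfl⟩)
      rw [Equiv.Perm.mul_apply, Equiv.swap_apply_left]
      exact mem_matchings.1 hp.1 k
  refine (card_le_card hsub).trans ((card_union_le _ _).trans ?_)
  rw [add_mul, one_mul]
  refine Nat.add_le_add_left ((card_union_le _ _).trans ?_) _
  have h1 := card_biUnion_le_card_mul (badPairs N) (fun p =>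
    (univ.filter fun i => p.1 p.2 ∈ N i).image fun i => (p.1, i)) D
    fun p _ => card_image_le.trans (hD _)
  have h2 := card_biUnion_le_card_mul (badPairs N) (fun p =>
    (univ.filter fun k => p.1 p.2 ∈ N k).image fun k => (p.1 * Equiv.swap p.2 k, p.2)) D
    fun p _ => card_image_le.trans (hD _)
  linarith

/-- A lower bound for the contribution of a mixed pair. -/
noncomputable def mixedGain (d D : ℕ) : ℝ := ((1 + 2 * D) * (d * (d + 1) ^ 2) : ℝ)⁻¹

theorem mixedGain_pos {d D : ℕ} (hd : 0 < d) : 0 < mixedGain d D := by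
  have : (0 : ℝ) < d := by exact_mod_cast hd
  unfold mixedGain
  positivity

/-- The Bregman–Minc inequality for constant row sums, with a gain for the mixed pairs. -/
theorem card_mul_log_card_add_mixedPairs_le {n d D : ℕ} (hd : 0 < d) {N : Fin n → Finset (Fin n)}
    (hN : ∀ i, (N i).card = d) (hD : ∀ c, (univ.filter fun i => c ∈ N i).card ≤ D) :
    ((matchings N).card : ℝ) * Real.log (matchings N).card +
        (mixedPairs N).card * mixedGain d D ≤
      (matchings N).card * (n / d * Real.log d.factorial) := by
  have hd' : (0 : ℝ) < d := by exact_mod_cast hd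
  refine le_trans (add_le_add_right ?_ _) (card_mul_log_card_add_badPairs_le hd hN)
  have h : ((mixedPairs N).card : ℝ) ≤ (1 + 2 * D) * (badPairs N).card := by
    exact_mod_cast card_mixedPairs_le hN hD
  rw [mixedGain, ← div_eq_mul_inv, div_le_div_iff₀ (by positivity) (by positivity)]
  calc ((mixedPairs N).card : ℝ) * (d * (d + 1) ^ 2)
      ≤ ((1 + 2 * D) * (badPairs N).card) * (d * (d + 1) ^ 2) := by gcongr
    _ = _ := by ring

/-! ### Matrices with contiguous rows -/

/-- The function `x` gives the first columns of the rows of a matrix in `Γ_n^d`. -/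
def Valid {n : ℕ} (d : ℕ) (x : Fin n → ℕ) : Prop := ∀ i, x i + d ≤ n

/-- The block of `d` columns starting at `x i`. -/
def block {n : ℕ} (d : ℕ) (x : Fin n → ℕ) (i : Fin n) : Finset (Fin n) :=
  univ.filter fun j => x i ≤ j ∧ (j : ℕ) < x i + d

/-- The matrix whose row `i` has the block of `d` ones starting at `x i`. -/
def blockMatrix {n : ℕ} (d : ℕ) (x : Fin n → ℕ) : Matrix (Fin n) (Fin n) ℕ :=
  Matrix.of fun i j => if x i ≤ j ∧ (j : ℕ) < x i + d then 1 else 0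

/-- The number of perfect matchings, that is, the permanent of `blockMatrix d x`. -/
def count {n : ℕ} (d : ℕ) (x : Fin n → ℕ) : ℕ := (matchings (block d x)).card

/-- The function `x` gives the first columns of the rows of a matrix in `M_n^d`. -/
def Optimal {n : ℕ} (d : ℕ) (x : Fin n → ℕ) : Prop :=
  Valid d x ∧ ∀ y : Fin n → ℕ, Valid d y → count d y ≤ count d x

theorem mem_block {n d : ℕ} {x : Fin n → ℕ} {i j : Fin n} :
    j ∈ block d x i ↔ x i ≤ j ∧ (j : ℕ) < x i + d := by
  simp [block]

theorem mem_matchings_block {n d : ℕ} {x : Fin n → ℕ} {σ : Equiv.Perm (Fin n)} :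
    σ ∈ matchings (block d x) ↔ ∀ i, x i ≤ σ i ∧ (σ i : ℕ) < x i + d := by
  simp [mem_matchings, mem_block]

theorem blockMatrix_apply {n d : ℕ} (x : Fin n → ℕ) (i j : Fin n) :
    blockMatrix d x i j = if j ∈ block d x i then 1 else 0 := by
  simp [blockMatrix, mem_block]

theorem permanent_blockMatrix {n d : ℕ} (x : Fin n → ℕ) :
    (blockMatrix d x).permanent = count d x := by
  -- In `Matrix.permanent` the permutation acts on the row index, in `matchings` on the column
  -- index.
  rw [← Matrix.permanent_transpose, Matrix.permanent, count, matchings, card_filter]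
  refine sum_congr rfl fun σ _ => ?_
  simp only [Matrix.transpose_apply, blockMatrix_apply]
  rw [prod_boole]
  simp

theorem mem_Gam_iff {n d : ℕ} {A : Matrix (Fin n) (Fin n) ℕ} :
    A ∈ Gam n d ↔ ∃ x : Fin n → ℕ, Valid d x ∧ A = blockMatrix d x := by
  constructor
  · intro h
    choose x hx using h
    refine ⟨x, fun i => (hx i).1, ?_⟩
    ext i j
    exact (hx i).2 j
  · rintro ⟨x, hx, rfl⟩ i
    exact ⟨x i, hx i, fun j => rfl⟩

theorem blockMatrix_mem_Opt_iff {n d : ℕ} {x : Fin n → ℕ} (hx : Valid d x) :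
    blockMatrix d x ∈ Opt n d ↔ Optimal d x := by
  constructor
  · intro h
    refine ⟨hx, fun y hy => ?_⟩
    rw [← permanent_blockMatrix, ← permanent_blockMatrix]
    exact h.2 _ (mem_Gam_iff.2 ⟨y, hy, rfl⟩)
  · intro h
    refine ⟨mem_Gam_iff.2 ⟨x, hx, rfl⟩, fun B hB => ?_⟩
    obtain ⟨y, hy, rfl⟩ := mem_Gam_iff.1 hB
    rw [permanent_blockMatrix, permanent_blockMatrix]
    exact h.2 y hy

theorem exists_of_mem_Opt {n d : ℕ} {A : Matrix (Fin n) (Fin n) ℕ} (hA : A ∈ Opt n d) :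
    ∃ x : Fin n → ℕ, Optimal d x ∧ A = blockMatrix d x := by
  obtain ⟨x, hx, rfl⟩ := mem_Gam_iff.1 hA.1
  exact ⟨x, (blockMatrix_mem_Opt_iff hx).1 hA, rfl⟩

theorem card_block {n d : ℕ} {x : Fin n → ℕ} (hx : Valid d x) (i : Fin n) :
    (block d x i).card = d := by
  have hi := hx i
  have : (block d x i).map Fin.valEmbedding = Ico (x i) (x i + d) := by
    ext j
    simp only [mem_map, mem_block, Fin.valEmbedding_apply, mem_Ico]
    constructor
    · rintro ⟨j, hj, rfl⟩
      exact hj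
    · intro hj
      exact ⟨⟨j, by omega⟩, hj, rfl⟩
  rw [← card_map Fin.valEmbedding, this]
  simp

theorem count_comp_perm {n d : ℕ} (x : Fin n → ℕ) (π : Equiv.Perm (Fin n)) :
    count d (x ∘ π) = count d x := by
  refine card_bij (fun σ _ => σ * π⁻¹) ?_ ?_ ?_
  · intro σ hσ
    rw [mem_matchings_block] at hσ ⊢
    intro i
    simpa using hσ (π⁻¹ i)
  · intro σ _ ρ _ h
    simpa using h
  · intro σ hσ
    refine ⟨σ * π, ?_, by simp⟩
    rw [mem_matchings_block] at hσ ⊢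
    intro i
    simpa using hσ (π i)

theorem Optimal.comp_perm {n d : ℕ} {x : Fin n → ℕ} (hx : Optimal d x)
    (π : Equiv.Perm (Fin n)) : Optimal d (x ∘ π) := by
  refine ⟨fun i => hx.1 (π i), fun y hy => ?_⟩
  rw [count_comp_perm]
  exact hx.2 y hy

theorem Optimal.of_count_le {n d : ℕ} {x y : Fin n → ℕ} (hx : Optimal d x) (hy : Valid d y)
    (h : count d x ≤ count d y) : Optimal d y :=
  ⟨hy, fun z hz => (hx.2 z hz).trans h⟩

theorem exists_count_pos {n d : ℕ} (hd : 0 < d) (hn : d ≤ n) :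
    ∃ y : Fin n → ℕ, Valid d y ∧ 0 < count d y := by
  refine ⟨fun i => min i (n - d), fun i => ?_, card_pos.2 ⟨1, ?_⟩⟩
  · have := min_le_right (i : ℕ) (n - d)
    change min (i : ℕ) (n - d) + d ≤ n
    omega
  · rw [mem_matchings_block]
    intro i
    have := i.2
    simp only [Equiv.Perm.one_apply]
    omega

theorem Valid.le_of_pos {n d : ℕ} {x : Fin n → ℕ} (hx : Valid d x) (hn : 0 < n) : d ≤ n := by
  have := hx ⟨0, hn⟩
  omega

theorem Optimal.count_pos {n d : ℕ} {x : Fin n → ℕ} (hd : 0 < d) (hx : Optimal d x) :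
    0 < count d x := by
  rcases Nat.eq_zero_or_pos n with rfl | hn
  · exact card_pos.2 ⟨1, mem_matchings_block.2 fun i => i.elim0⟩
  · obtain ⟨y, hy, hpos⟩ := exists_count_pos hd (hx.1.le_of_pos hn)
    exact hpos.trans_le (hx.2 y hy)

theorem count_zero {d : ℕ} : count d (fun _ : Fin d => 0) = d.factorial := by
  have : matchings (block d (fun _ : Fin d => 0)) = univ := by
    ext σ
    simp [mem_matchings_block]
  rw [count, this, card_univ, Fintype.card_perm, Fintype.card_fin]

/-! ### Direct sums -/

/-- The first columns of the rows of the direct sum. -/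
def glue {a b : ℕ} (x : Fin a → ℕ) (y : Fin b → ℕ) : Fin (a + b) → ℕ :=
  Fin.append x fun j => a + y j

@[simp]
theorem glue_castAdd {a b : ℕ} (x : Fin a → ℕ) (y : Fin b → ℕ) (i : Fin a) :
    glue x y (Fin.castAdd b i) = x i := by
  simp [glue]

@[simp]
theorem glue_natAdd {a b : ℕ} (x : Fin a → ℕ) (y : Fin b → ℕ) (i : Fin b) :
    glue x y (Fin.natAdd a i) = a + y i := by
  simp [glue]

theorem Valid.glue {a b d : ℕ} {x : Fin a → ℕ} {y : Fin b → ℕ} (hx : Valid d x)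
    (hy : Valid d y) : Valid d (glue x y) := by
  intro i
  refine Fin.addCases (fun i => ?_) (fun i => ?_) i
  · rw [glue_castAdd]
    have := hx i
    omega
  · rw [glue_natAdd]
    have := hy i
    omega

/-- The rows of the first summand use up the first `a` columns, so every matching splits. -/
theorem count_glue {a b d : ℕ} {x : Fin a → ℕ} (hx : Valid d x) (y : Fin b → ℕ) :
    count d (glue x y) = count d x * count d y := by
  symm
  rw [count, count, count, ← card_product]
  refine card_bij (fun p _ => finSumFinEquiv.permCongr (Equiv.Perm.sumCongr p.1 p.2)) ?_ ?_ ?_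
  · rintro ⟨σ, ρ⟩ h
    rw [mem_product, mem_matchings_block, mem_matchings_block] at h
    rw [mem_matchings_block]
    intro i
    refine Fin.addCases (fun i => ?_) (fun i => ?_) i
    · simpa [Equiv.permCongr_apply] using h.1 i
    · have := h.2 i
      simp only [Equiv.permCongr_apply, finSumFinEquiv_symm_apply_natAdd,
        Equiv.Perm.sumCongr_apply, Sum.map_inr, finSumFinEquiv_apply_right, Fin.val_natAdd,
        glue_natAdd]
      dsimp only at this
      omega
  · rintro ⟨σ, ρ⟩ _ ⟨σ', ρ'⟩ _ h
    exact Equiv.Perm.sumCongrHom_injective (finSumFinEquiv.permCongr.injective h)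
  · intro σ hσ
    rw [mem_matchings_block] at hσ
    have hmaps : Set.MapsTo (finSumFinEquiv.symm.permCongr σ) (Set.range Sum.inl)
        (Set.range Sum.inl) := by
      rintro _ ⟨i, rfl⟩
      have h1 := hσ (Fin.castAdd b i)
      rw [glue_castAdd] at h1
      have h2 := hx i
      refine ⟨⟨σ (Fin.castAdd b i), by omega⟩, ?_⟩
      simp only [Equiv.permCongr_apply, Equiv.symm_symm, finSumFinEquiv_apply_left]
      rw [Equiv.eq_symm_apply]
      rfl
    obtain ⟨⟨σ₁, σ₂⟩, hσ₁₂⟩ := Equiv.Perm.mem_sumCongrHom_range_of_perm_mapsTo_inl hmaps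
    have heq : σ = finSumFinEquiv.permCongr (Equiv.Perm.sumCongr σ₁ σ₂) := by
      rw [← Equiv.symm_apply_eq]
      exact hσ₁₂.symm
    refine ⟨(σ₁, σ₂), ?_, heq.symm⟩
    rw [mem_product, mem_matchings_block, mem_matchings_block]
    constructor
    · intro i
      have := hσ (Fin.castAdd b i)
      rw [heq] at this
      simpa [Equiv.permCongr_apply] using this
    · intro i
      have := hσ (Fin.natAdd a i)
      rw [heq] at this
      simp only [Equiv.permCongr_apply, finSumFinEquiv_symm_apply_natAdd,
        Equiv.Perm.sumCongr_apply, Sum.map_inr, finSumFinEquiv_apply_right, Fin.val_natAdd,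
        glue_natAdd] at this
      dsimp only
      omega

/-- Split off all-ones blocks while the order is at least `2 * d`; the remainder has order at least
`d` and admits a positive permanent. -/
theorem exists_factorial_pow_le_count {d : ℕ} (hd : 0 < d) (n : ℕ) (hn : d ≤ n) :
    ∃ y : Fin n → ℕ, Valid d y ∧ d.factorial ^ (n / d - 1) ≤ count d y := by
  induction n using Nat.strong_induction_on with
  | _ n ih =>
    by_cases h2 : n < d + d
    · obtain ⟨y, hy, hpos⟩ := exists_count_pos hd hn
      refine ⟨y, hy, ?_⟩
      have : n / d - 1 = 0 := by
        have := (Nat.div_lt_iff_lt_mul hd).2 (by linarith : n < 2 * d)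
        omega
      rw [this, pow_zero]
      exact hpos
    · obtain ⟨k, rfl⟩ := Nat.exists_eq_add_of_le hn
      obtain ⟨y, hy, hle⟩ := ih k (by omega) (by omega)
      refine ⟨glue (fun _ : Fin d => 0) y, Valid.glue (fun _ => by simp) hy, ?_⟩
      have hv : Valid d (fun _ : Fin d => 0) := fun _ => by simp
      rw [count_glue hv, count_zero, Nat.add_div_left _ hd]
      have : (k / d).succ - 1 = (k / d - 1) + 1 := by
        have := Nat.div_pos (show d ≤ k by omega) hd
        omega
      rw [this, pow_succ']
      exact Nat.mul_le_mul_left _ hle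

/-! ### Consequences of the refined inequality -/

/-- A matching sends the rows through column `c` injectively to columns at distance less than `d`
from `c`. -/
theorem card_filter_mem_block_le {n d : ℕ} {x : Fin n → ℕ} (hpos : 0 < count d x) (c : Fin n) :
    (univ.filter fun i => c ∈ block d x i).card ≤ 2 * d := by
  obtain ⟨σ, hσ⟩ := card_pos.1 hpos
  rw [mem_matchings_block] at hσ
  calc (univ.filter fun i => c ∈ block d x i).card
      ≤ (Ico (c + 1 - d : ℕ) (c + d)).card := by
        refine card_le_card_of_injOn (fun i => (σ i : ℕ)) ?_ ?_
        · intro i hi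
          rw [mem_coe, mem_filter, mem_block] at hi
          have := hσ i
          simp only [coe_Ico, Set.mem_Ico]
          omega
        · intro i _ j _ h
          exact σ.injective (Fin.ext h)
    _ ≤ 2 * d := by
        rw [Nat.card_Ico]
        omega

theorem log_count_add_le {n d : ℕ} (hd : 0 < d) {x : Fin n → ℕ} (hx : Valid d x)
    (hpos : 0 < count d x) :
    Real.log (count d x) + (mixedPairs (block d x)).card * mixedGain d (2 * d) / count d x ≤
      n / d * Real.log d.factorial := by
  have h := card_mul_log_card_add_mixedPairs_le hd (card_block hx) (card_filter_mem_block_le hpos)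
  have hpos' : (0 : ℝ) < count d x := by exact_mod_cast hpos
  refine le_of_mul_le_mul_left ?_ hpos'
  rw [mul_add, mul_div_cancel₀ _ hpos'.ne']
  exact h

theorem count_pow_lt {n d : ℕ} (hd : 0 < d) {x : Fin n → ℕ} (hx : Valid d x)
    (hmix : (mixedPairs (block d x)).Nonempty) : count d x ^ d < d.factorial ^ n := by
  have hpos : 0 < count d x := by
    obtain ⟨p, hp⟩ := hmix
    exact card_pos.2 ⟨p.1, (mem_product.1 (mem_filter.1 hp).1).1⟩
  have hd' : (0 : ℝ) < d := by exact_mod_cast hd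
  have hpos' : (0 : ℝ) < count d x := by exact_mod_cast hpos
  have hfac : (0 : ℝ) < d.factorial := by exact_mod_cast d.factorial_pos
  have hm : (0 : ℝ) < (mixedPairs (block d x)).card := by exact_mod_cast card_pos.2 hmix
  have hg := mixedGain_pos (d := d) (D := 2 * d) hd
  have h := log_count_add_le hd hx hpos
  have h' : 0 < (mixedPairs (block d x)).card * mixedGain d (2 * d) / count d x := by positivity
  have h2 : Real.log (count d x) < n / d * Real.log d.factorial := by linarith
  have h3 : d * Real.log (count d x) < n * Real.log d.factorial := by
    rw [div_mul_eq_mul_div, lt_div_iff₀ hd'] at h2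
    linarith
  rw [← Real.log_pow, ← Real.log_pow, Real.log_lt_log_iff (by positivity) (by positivity)] at h3
  exact_mod_cast h3

/-- The rows which have fewer than `d` copies. -/
def rareRows {n : ℕ} (d : ℕ) (x : Fin n → ℕ) : Finset (Fin n) :=
  univ.filter fun i => (univ.filter fun k => block d x k = block d x i).card < d

/-- A row that is not mixed in a matching has `d` partners that are all copies of it; hence a rare
row is mixed in every matching. -/
theorem count_mul_card_rareRows_le {n d : ℕ} {x : Fin n → ℕ} (hx : Valid d x) :
    count d x * (rareRows d x).card ≤ (mixedPairs (block d x)).card := by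
  rw [count, ← card_product]
  refine card_le_card fun p hp => ?_
  rw [mem_product] at hp
  rw [mixedPairs, mem_filter, mem_product]
  refine ⟨⟨hp.1, mem_univ _⟩, ?_⟩
  by_contra hmix
  simp only [Mixed, not_exists, not_and, not_not] at hmix
  have hlt := (mem_filter.1 hp.2).2
  have hsub : partners (block d x) p.1 p.2 ⊆
      univ.filter fun k => block d x k = block d x p.2 := fun k hk =>
    mem_filter.2 ⟨mem_univ _, hmix k (mem_filter.1 hk).2⟩
  have := card_le_card hsub
  rw [card_partners, card_block hx] at this
  omega

theorem card_rareRows_le {n d : ℕ} (hd : 0 < d) {x : Fin n → ℕ} (hx : Optimal d x) :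
    ((rareRows d x).card : ℝ) ≤ 2 * Real.log d.factorial / mixedGain d (2 * d) := by
  have hg := mixedGain_pos (d := d) (D := 2 * d) hd
  have hlog : 0 ≤ Real.log d.factorial := Real.log_natCast_nonneg _
  rcases Nat.eq_zero_or_pos n with rfl | hn
  · rw [eq_empty_of_isEmpty (rareRows d x), card_empty, Nat.cast_zero]
    positivity
  have hpos := hx.count_pos hd
  have hpos' : (0 : ℝ) < count d x := by exact_mod_cast hpos
  have hd' : (0 : ℝ) < d := by exact_mod_cast hd
  have hfac : (0 : ℝ) < d.factorial := by exact_mod_cast d.factorial_pos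
  obtain ⟨y, hy, hle⟩ := exists_factorial_pow_le_count hd n (hx.1.le_of_pos hn)
  have h1 : ((d.factorial : ℝ)) ^ (n / d - 1) ≤ count d x := by
    exact_mod_cast hle.trans (hx.2 y hy)
  have h2 := Real.log_le_log (by positivity) h1
  rw [Real.log_pow] at h2
  -- One unit goes to rounding down `n / d`, the other to the remainder block; this is the factor
  -- `2` of the bound.
  have h3 : (n : ℝ) / d - 2 ≤ ((n / d - 1 : ℕ) : ℝ) := by
    have h4 : (n : ℝ) / d ≤ (n / d : ℕ) + 1 := by
      rw [div_le_iff₀ hd']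
      have := Nat.lt_mul_div_succ n hd
      have : n ≤ (n / d + 1) * d := by linarith
      exact_mod_cast this
    have h5 : ((n / d : ℕ) : ℝ) ≤ ((n / d - 1 : ℕ) : ℝ) + 1 := by
      have : n / d ≤ (n / d - 1) + 1 := by omega
      exact_mod_cast this
    linarith
  have h6 := log_count_add_le hd hx.1 hpos
  have h7 : (rareRows d x).card * mixedGain d (2 * d) ≤
      (mixedPairs (block d x)).card * mixedGain d (2 * d) / count d x := by
    rw [le_div_iff₀ hpos']
    have : (count d x : ℝ) * (rareRows d x).card ≤ (mixedPairs (block d x)).card := by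
      exact_mod_cast count_mul_card_rareRows_le hx.1
    calc _ = (count d x : ℝ) * (rareRows d x).card * mixedGain d (2 * d) := by ring
      _ ≤ _ := by gcongr
  rw [le_div_iff₀ hg]
  have h8 := mul_le_mul_of_nonneg_right h3 hlog
  rw [sub_mul] at h8
  linarith

theorem containsOnes_of_card {n d : ℕ} {B : Matrix (Fin n) (Fin n) ℕ} {R T : Finset (Fin n)}
    (hR : d ≤ R.card) (hT : d ≤ T.card) (h : ∀ i ∈ R, ∀ j ∈ T, B i j = 1) : ContainsOnes d B := by
  refine ⟨(R.orderEmbOfCardLe hR).toEmbedding, (T.orderEmbOfCardLe hT).toEmbedding, ?_⟩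
  ext i j
  exact h _ (orderEmbOfCardLe_mem _ _ _) _ (orderEmbOfCardLe_mem _ _ _)

/-- All copies of a row, and all its columns, lie in one component. So in a component without
`1_{d×d}` every row is rare. -/
theorem componentBounds_nonempty {d : ℕ} (hd : 0 < d) : (componentBounds d).Nonempty := by
  refine ⟨⌊2 * Real.log d.factorial / mixedGain d (2 * d)⌋₊, ?_⟩
  intro n A hA k m C hC i hi
  obtain ⟨x, hx, rfl⟩ := exists_of_mem_Opt hA
  obtain ⟨⟨e, f, hef⟩, -⟩ := hC
  refine Nat.le_floor ((?_ : (m i : ℝ) ≤ (rareRows d x).card).trans (card_rareRows_le hd hx))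
  have hentry : ∀ u v, blockMatrix d x u v = Matrix.blockDiagonal' C (e u) (f v) := by
    intro u v
    rw [← hef]
    rfl
  have hfst : ∀ u v, v ∈ block d x u → (e u).1 = (f v).1 := by
    intro u v huv
    by_contra hne
    have h1 := hentry u v
    rw [blockMatrix_apply, if_pos huv, Matrix.blockDiagonal'_apply, dif_neg hne] at h1
    exact one_ne_zero h1
  have hinj : Function.Injective fun j : Fin (m i) => e.symm ⟨i, j⟩ := fun j j' h => by
    simpa using h
  suffices h : m i ≤ (rareRows d x).card by exact_mod_cast h
  rw [← Fintype.card_fin (m i), ← card_univ, ← card_image_of_injective univ hinj]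
  refine card_le_card fun u hu => ?_
  obtain ⟨j, -, rfl⟩ := mem_image.1 hu
  rw [rareRows, mem_filter]
  refine ⟨mem_univ _, ?_⟩
  by_contra hge
  rw [not_lt] at hge
  apply hi
  set u := e.symm ⟨i, j⟩ with hu'
  have hcol : ∀ v ∈ block d x u, (f v).1 = i := by
    intro v hv
    rw [← hfst u v hv, hu', Equiv.apply_symm_apply]
  have hrow : ∀ u', block d x u' = block d x u → (e u').1 = i := by
    intro u' h
    obtain ⟨v, hv⟩ := card_pos.1 (by rw [card_block hx.1 u]; exact hd)
    rw [hfst u' v (by rw [h]; exact hv), hcol v hv]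
  refine containsOnes_of_card
    (R := univ.filter fun j' => block d x (e.symm ⟨i, j'⟩) = block d x u)
    (T := univ.filter fun j' => f.symm ⟨i, j'⟩ ∈ block d x u) ?_ ?_ ?_
  · refine hge.trans ((card_le_card (t := (univ.filter fun j' : Fin (m i) =>
      block d x (e.symm ⟨i, j'⟩) = block d x u).image fun j' => e.symm ⟨i, j'⟩) ?_).trans
      card_image_le)
    intro u' hu'
    have hu'' := (mem_filter.1 hu').2
    obtain ⟨⟨i', j'⟩, rfl⟩ := e.symm.surjective u'
    have h := hrow _ hu''
    rw [Equiv.apply_symm_apply] at h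
    dsimp only at h
    subst h
    exact mem_image.2 ⟨j', mem_filter.2 ⟨mem_univ _, hu''⟩, rfl⟩
  · refine (card_block hx.1 u).ge.trans ((card_le_card (t := (univ.filter fun j' : Fin (m i) =>
      f.symm ⟨i, j'⟩ ∈ block d x u).image fun j' => f.symm ⟨i, j'⟩) ?_).trans
      card_image_le)
    intro v hv
    obtain ⟨⟨i', j'⟩, rfl⟩ := f.symm.surjective v
    have h := hcol _ hv
    rw [Equiv.apply_symm_apply] at h
    dsimp only at h
    subst h
    exact mem_image.2 ⟨j', mem_filter.2 ⟨mem_univ _, hv⟩, rfl⟩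
  · intro a ha b hb
    have h := hentry (e.symm ⟨i, a⟩) (f.symm ⟨i, b⟩)
    rw [Equiv.apply_symm_apply, Equiv.apply_symm_apply, Matrix.blockDiagonal'_apply_eq,
      blockMatrix_apply, if_pos] at h
    · exact h.symm
    · rw [(mem_filter.1 ha).2]
      exact (mem_filter.1 hb).2

/-! ### Sorted rows and exchange arguments -/

theorem perm_lt_iff {n : ℕ} {σ : Equiv.Perm (Fin n)} {a : ℕ}
    (h : ∀ i : Fin n, (i : ℕ) < a → (σ i : ℕ) < a) (i : Fin n) : (σ i : ℕ) < a ↔ (i : ℕ) < a := by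
  refine ⟨fun hi => ?_, h i⟩
  have := Equiv.Perm.perm_symm_on_of_perm_on_finite (f := σ) (p := fun i : Fin n => (i : ℕ) < a) h hi
  simpa using this

theorem perm_ge_iff {n : ℕ} {σ : Equiv.Perm (Fin n)} {a : ℕ}
    (h : ∀ i : Fin n, a ≤ (i : ℕ) → a ≤ (σ i : ℕ)) (i : Fin n) : a ≤ (σ i : ℕ) ↔ a ≤ (i : ℕ) := by
  refine ⟨fun hi => ?_, h i⟩
  have := Equiv.Perm.perm_symm_on_of_perm_on_finite (f := σ) (p := fun i : Fin n => a ≤ (i : ℕ)) h hi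
  simpa using this

/-- Otherwise either all rows from `i` on are matched beyond column `i`, or all rows up to `i`
before it, and there are too few such columns. -/
theorem le_and_lt_of_monotone {n d : ℕ} {x : Fin n → ℕ} (hmono : Monotone x)
    (hpos : 0 < count d x) (i : Fin n) : x i ≤ i ∧ (i : ℕ) < x i + d := by
  obtain ⟨σ, hσ⟩ := card_pos.1 hpos
  rw [mem_matchings_block] at hσ
  constructor
  · by_contra hlt
    have h : ∀ j : Fin n, (i : ℕ) ≤ j → (i : ℕ) < σ j := by
      intro j hj
      have h1 := hσ j
      have h2 : x i ≤ x j := hmono hj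
      omega
    have h3 := (perm_ge_iff (fun j hj => (h j hj).le) (σ.symm i)).1 (by simp)
    have := h _ h3
    simp at this
  · by_contra hge
    have h : ∀ j : Fin n, (j : ℕ) < i + 1 → (σ j : ℕ) < i := by
      intro j hj
      have h1 := hσ j
      have h2 : x j ≤ x i := hmono (Fin.le_def.2 (by omega))
      omega
    have h3 := (perm_lt_iff (fun j hj => (h j hj).trans (Nat.lt_succ_self _)) (σ.symm i)).1
      (by simp)
    have := h _ h3
    simp at this

theorem one_mem_matchings_of_monotone {n d : ℕ} {x : Fin n → ℕ} (hmono : Monotone x)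
    (hpos : 0 < count d x) : 1 ∈ matchings (block d x) :=
  mem_matchings_block.2 fun i => le_and_lt_of_monotone hmono hpos i

/-- The matchings of all the rows but `r`, with `r` sent to `c`. -/
def cofactor {n : ℕ} (d : ℕ) (x : Fin n → ℕ) (r c : Fin n) : Finset (Equiv.Perm (Fin n)) :=
  univ.filter fun σ => σ r = c ∧ ∀ j, j ≠ r → x j ≤ σ j ∧ (σ j : ℕ) < x j + d

theorem mem_cofactor {n d : ℕ} {x : Fin n → ℕ} {r c : Fin n} {σ : Equiv.Perm (Fin n)} :
    σ ∈ cofactor d x r c ↔ σ r = c ∧ ∀ j, j ≠ r → x j ≤ σ j ∧ (σ j : ℕ) < x j + d := by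
  simp [cofactor]

theorem count_update {n d : ℕ} (x : Fin n → ℕ) (r : Fin n) (z : ℕ) :
    count d (Function.update x r z) =
      ∑ c ∈ univ.filter (fun c : Fin n => z ≤ (c : ℕ) ∧ (c : ℕ) < z + d), (cofactor d x r c).card := by
  rw [count, card_eq_sum_card_fiberwise (f := fun σ : Equiv.Perm (Fin n) => σ r)
    (t := univ.filter fun c : Fin n => z ≤ c ∧ (c : ℕ) < z + d)]
  · refine sum_congr rfl fun c hc => ?_
    congr 1
    ext σ
    rw [mem_filter, mem_matchings_block, mem_cofactor, and_comm]
    refine and_congr_right fun hr => ⟨fun h j hj => ?_, fun h j => ?_⟩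
    · simpa [Function.update_of_ne hj] using h j
    · by_cases hj : j = r
      · subst hj
        rw [Function.update_self, hr]
        exact (mem_filter.1 hc).2
      · rw [Function.update_of_ne hj]
        exact h j hj
  · intro σ hσ
    rw [mem_coe, mem_matchings_block] at hσ
    have := hσ r
    rw [Function.update_self] at this
    simpa using this

/-- The hypotheses of the exchange argument: the rows before `t` lie in the columns before `t`, the
rows from `e` on lie in the columns from `e` on, and the rows in between are as far to the right
as possible. -/
structure Gap {n : ℕ} (d : ℕ) (x : Fin n → ℕ) (t e : ℕ) : Prop where
  lt : t < e
  le : e ≤ n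
  lt_add : e < t + d
  pos : d ≤ t
  pre : ∀ i : Fin n, (i : ℕ) < t → x i + d ≤ t
  mid : ∀ i : Fin n, t ≤ (i : ℕ) → (i : ℕ) < e → x i + d = e
  suf : ∀ i : Fin n, e ≤ (i : ℕ) → e ≤ x i

namespace Gap

variable {n d : ℕ} {x : Fin n → ℕ} {t e : ℕ}

theorem lt_iff (h : Gap d x t e) {r c : Fin n} (hc : (c : ℕ) < t)
    {σ : Equiv.Perm (Fin n)} (hσ : σ ∈ cofactor d x r c) (i : Fin n) :
    (σ i : ℕ) < t ↔ (i : ℕ) < t := by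
  rw [mem_cofactor] at hσ
  refine perm_lt_iff (fun j hj => ?_) i
  by_cases hjr : j = r
  · rw [hjr, hσ.1]
    exact hc
  · have h1 := hσ.2 j hjr
    have h2 := h.pre j hj
    omega

theorem ge_iff (h : Gap d x t e) {r c : Fin n} (hr : (r : ℕ) < t)
    {σ : Equiv.Perm (Fin n)} (hσ : σ ∈ cofactor d x r c) (i : Fin n) :
    e ≤ (σ i : ℕ) ↔ e ≤ (i : ℕ) := by
  rw [mem_cofactor] at hσ
  have := h.lt
  refine perm_ge_iff (fun j hj => ?_) i
  have hjr : j ≠ r := by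
    rintro rfl
    omega
  have h1 := hσ.2 j hjr
  have h2 := h.suf j hj
  omega

/-- By `lt_iff` and `ge_iff` the row matched to `c'` is a middle row. Its block runs from `e - d` to
`e - 1` and contains `c`, so it can take `c` and leave `c'` to `r`. -/
theorem swap_mul_mem (h : Gap d x t e) {r c c' : Fin n} (hr : (r : ℕ) < t) (hc : (c : ℕ) < t)
    (hec : e ≤ c + d) (hc' : t ≤ (c' : ℕ)) (hc'e : (c' : ℕ) < e) {σ : Equiv.Perm (Fin n)}
    (hσ : σ ∈ cofactor d x r c) : Equiv.swap c c' * σ ∈ cofactor d x r c' := by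
  have hlt := h.lt_iff hc hσ
  have hge := h.ge_iff hr hσ
  have hte := h.lt
  rw [mem_cofactor] at hσ ⊢
  refine ⟨by simp [hσ.1], fun j hj => ?_⟩
  rw [Equiv.Perm.mul_apply]
  by_cases h1 : σ j = c'
  · have h2 := hlt j
    have h3 := hge j
    rw [h1] at h2 h3
    have h4 := h.mid j (by omega) (by omega)
    rw [h1, Equiv.swap_apply_right]
    omega
  · rw [Equiv.swap_apply_of_ne_of_ne _ h1]
    · exact hσ.2 j hj
    · rw [← hσ.1]
      exact fun hh => hj (σ.injective hh)

theorem card_cofactor_le (h : Gap d x t e) {r c c' : Fin n} (hr : (r : ℕ) < t)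
    (hc : (c : ℕ) < t) (hec : e ≤ c + d) (hc' : t ≤ (c' : ℕ)) (hc'e : (c' : ℕ) < e) :
    (cofactor d x r c).card ≤ (cofactor d x r c').card :=
  card_le_card_of_injOn (fun σ => Equiv.swap c c' * σ)
    (fun _ hσ => h.swap_mul_mem hr hc hec hc' hc'e hσ) fun _ _ _ _ hh => mul_left_cancel hh

/-- The exchanges with `c₁` and `c₂` have disjoint images: after the first, column `c₁` belongs to a
middle row; after the second, to a row before `t`. -/
theorem card_cofactor_add_le (h : Gap d x t e) {r c₁ c₂ c' : Fin n} (hr : (r : ℕ) < t)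
    (hne : c₁ ≠ c₂) (hc₁ : (c₁ : ℕ) < t) (hec₁ : e ≤ c₁ + d) (hc₂ : (c₂ : ℕ) < t)
    (hec₂ : e ≤ c₂ + d) (hc' : t ≤ (c' : ℕ)) (hc'e : (c' : ℕ) < e) :
    (cofactor d x r c₁).card + (cofactor d x r c₂).card ≤ (cofactor d x r c').card := by
  classical
  rw [← card_image_of_injective (cofactor d x r c₁) (mul_right_injective (Equiv.swap c₁ c')),
    ← card_image_of_injective (cofactor d x r c₂) (mul_right_injective (Equiv.swap c₂ c')),
    ← card_union_of_disjoint]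
  · refine card_le_card (union_subset ?_ ?_)
    · intro ρ hρ
      obtain ⟨σ, hσ, rfl⟩ := mem_image.1 hρ
      exact h.swap_mul_mem hr hc₁ hec₁ hc' hc'e hσ
    · intro ρ hρ
      obtain ⟨σ, hσ, rfl⟩ := mem_image.1 hρ
      exact h.swap_mul_mem hr hc₂ hec₂ hc' hc'e hσ
  · rw [disjoint_left]
    intro ρ hρ₁ hρ₂
    obtain ⟨σ₁, hσ₁, rfl⟩ := mem_image.1 hρ₁
    obtain ⟨σ₂, hσ₂, h12⟩ := mem_image.1 hρ₂
    obtain ⟨j, hj⟩ := σ₁.surjective c'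
    have h1 := h.lt_iff hc₁ hσ₁ j
    have h2 := h.lt_iff hc₂ hσ₂ j
    have h3 : σ₂ j = c₁ := by
      have h4 : Equiv.swap c₂ c' (σ₂ j) = c₁ := by
        rw [← Equiv.Perm.mul_apply, h12, Equiv.Perm.mul_apply, hj, Equiv.swap_apply_right]
      rw [Equiv.swap_apply_eq_iff, Equiv.swap_apply_of_ne_of_ne hne] at h4
      · exact h4
      · rintro rfl
        omega
    rw [hj] at h1
    rw [h3] at h2
    omega

/-- A row before `t` that reaches column `t - 1` starts at `t - d`, so it can trade the one column
for the other. -/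
theorem card_cofactor_first_le_last (h : Gap d x t e) {r c c' : Fin n} (hc : (c : ℕ) + d = t)
    (hc' : (c' : ℕ) + 1 = t) (hd : 0 < d) :
    (cofactor d x r c).card ≤ (cofactor d x r c').card := by
  refine card_le_card_of_injOn (fun σ => Equiv.swap c c' * σ) (fun σ hσ => ?_)
    fun _ _ _ _ hh => mul_left_cancel hh
  rw [mem_coe] at hσ ⊢
  have hlt := h.lt_iff (by omega) hσ
  rw [mem_cofactor] at hσ ⊢
  refine ⟨by simp [hσ.1], fun j hj => ?_⟩
  rw [Equiv.Perm.mul_apply]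
  by_cases h1 : σ j = c'
  · have h2 := hlt j
    have h3 := hσ.2 j hj
    rw [h1] at h2 h3
    have h4 := h.pre j (by omega)
    rw [h1, Equiv.swap_apply_right]
    omega
  · rw [Equiv.swap_apply_of_ne_of_ne _ h1]
    · exact hσ.2 j hj
    · rw [← hσ.1]
      exact fun hh => hj (σ.injective hh)

/-- In every matching, column `t - 1` belongs to a row with the same block as `r`, and this row can
change places with `r`. -/
theorem count_le_mul (h : Gap d x t e) {r c : Fin n} (hr : x r + d = t)
    (hc : (c : ℕ) + 1 = t) :
    count d x ≤ (univ.filter fun j : Fin n => (j : ℕ) < t ∧ x j + d = t).card *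
      (cofactor d x r c).card := by
  classical
  refine (card_le_card (t := (univ.filter fun j : Fin n => (j : ℕ) < t ∧ x j + d = t).biUnion
    fun j => (cofactor d x r c).image fun ρ => ρ * Equiv.swap r j) ?_).trans
    (card_biUnion_le_card_mul _ _ _ fun j _ => card_image_le)
  intro σ hσ
  rw [mem_matchings_block] at hσ
  obtain ⟨j, hj⟩ := σ.surjective c
  have hjt : (j : ℕ) < t := by
    refine (perm_lt_iff (σ := σ) (fun i hi => ?_) j).1 (by rw [hj]; omega)
    have h1 := hσ i
    have h2 := h.pre i hi
    omega
  have h1 := h.pre j hjt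
  have h2 := hσ j
  rw [hj] at h2
  have hxj : x j + d = t := by omega
  rw [mem_biUnion]
  refine ⟨j, mem_filter.2 ⟨mem_univ _, hjt, hxj⟩, mem_image.2 ⟨σ * Equiv.swap r j, ?_, ?_⟩⟩
  · rw [mem_cofactor]
    refine ⟨by simp [hj], fun k hk => ?_⟩
    rw [Equiv.Perm.mul_apply]
    by_cases hkj : k = j
    · subst hkj
      rw [Equiv.swap_apply_right]
      have := hσ r
      omega
    · rw [Equiv.swap_apply_of_ne_of_ne hk hkj]
      exact hσ k
  · simp [mul_assoc]

theorem le_card_of_optimal (h : Gap d x t e) (hd : 0 < d) (hx : Optimal d x)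
    (hmono : Monotone x) :
    d ≤ (univ.filter fun j : Fin n => (j : ℕ) < t ∧ x j + d = t).card := by
  obtain ⟨hte, hen, hetd, hdt, hpre, hmid, hsuf⟩ := id h
  have hpos := hx.count_pos hd
  have hdiag := le_and_lt_of_monotone hmono hpos
  set r : Fin n := ⟨t - 1, by omega⟩ with hr
  have hrv : (r : ℕ) = t - 1 := rfl
  have hrt : (r : ℕ) < t := by omega
  have hr1 : (r : ℕ) + 1 = t := by omega
  have hxr : x r + d = t := by
    have h1 := hdiag r
    have h2 := hpre r hrt
    omega
  set s := (univ.filter fun j : Fin n => (j : ℕ) < t ∧ x j + d = t).card with hs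
  have hq : 0 < (cofactor d x r r).card :=
    card_pos.2 ⟨1, mem_cofactor.2 ⟨rfl, fun j _ => hdiag j⟩⟩
  have hle := h.count_le_mul (c := r) hxr hr1
  rw [← hs] at hle
  -- Let row `t - 1` end at `e` instead of `t`. Each of the columns `t - 1, …, e - 1` then
  -- contributes at least the cofactor of column `t - 1`, and optimality compares this with
  -- `count_le_mul`.
  have hws : e - t + 1 ≤ s := by
    have hv : Valid d (Function.update x r (e - d)) := by
      intro i
      by_cases hi : i = r
      · rw [hi, Function.update_self]
        omega
      · rw [Function.update_of_ne hi]
        exact hx.1 i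
    have h1 := (hx.2 _ hv).trans hle
    rw [count_update] at h1
    have h2 : ((univ.filter fun c : Fin n => t - 1 ≤ (c : ℕ) ∧ (c : ℕ) < e)).card •
        (cofactor d x r r).card ≤
        ∑ c ∈ univ.filter (fun c : Fin n => e - d ≤ (c : ℕ) ∧ (c : ℕ) < e - d + d),
          (cofactor d x r c).card := by
      refine (card_nsmul_le_sum _ (fun c => (cofactor d x r c).card) _ fun c hc => ?_).trans
        (sum_le_sum_of_subset fun c hc => ?_)
      · have hc' := (mem_filter.1 hc).2
        by_cases hct : (c : ℕ) < t
        · rw [show c = r from Fin.ext (by omega)]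
        · exact h.card_cofactor_le hrt (by omega) (by omega) (by omega) (by omega)
      · rw [mem_filter] at hc ⊢
        refine ⟨mem_univ _, ?_⟩
        omega
    have h3 : ((univ.filter fun c : Fin n => t - 1 ≤ (c : ℕ) ∧ (c : ℕ) < e)).card =
        e - t + 1 := by
      rw [← card_map Fin.valEmbedding]
      have : (univ.filter fun c : Fin n => t - 1 ≤ (c : ℕ) ∧ (c : ℕ) < e).map Fin.valEmbedding =
          Ico (t - 1) e := by
        ext j
        simp only [mem_map, mem_filter, mem_univ, true_and, Fin.valEmbedding_apply, mem_Ico]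
        constructor
        · rintro ⟨j, hj, rfl⟩
          exact hj
        · intro hj
          exact ⟨⟨j, by omega⟩, hj, rfl⟩
      rw [this, Nat.card_Ico]
      omega
    rw [h3, smul_eq_mul] at h2
    exact Nat.le_of_mul_le_mul_right (h2.trans h1) hq
  by_contra hsd
  rw [not_le] at hsd
  obtain ⟨j, hj, hjr⟩ := exists_mem_ne (s := univ.filter fun j : Fin n => (j : ℕ) < t ∧ x j + d = t)
    (by omega) r
  have hj' := (mem_filter.1 hj).2
  have hjv : (j : ℕ) ≠ t - 1 := fun hh => hjr (Fin.ext hh)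
  set r' : Fin n := ⟨t - 2, by omega⟩ with hr'
  have hr'v : (r' : ℕ) = t - 2 := rfl
  have hr'r : r' ≠ r := fun hh => by
    have := congrArg Fin.val hh
    omega
  have hxr' : x r' + d = t := by
    have h1 : x j ≤ x r' := hmono (Fin.le_def.2 (by omega))
    have h2 := hpre r' (by omega)
    omega
  have hq' : 0 < (cofactor d x r r').card := by
    refine card_pos.2 ⟨Equiv.swap r r', mem_cofactor.2 ⟨by simp, fun k hk => ?_⟩⟩
    by_cases hkr : k = r'
    · rw [hkr, Equiv.swap_apply_right]
      omega
    · rw [Equiv.swap_apply_of_ne_of_ne hk hkr]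
      exact hdiag k
  set c₀ : Fin n := ⟨t - d, by omega⟩ with hc₀
  have hc₀v : (c₀ : ℕ) = t - d := rfl
  set c₁ : Fin n := ⟨t, by omega⟩ with hc₁
  have hc₁v : (c₁ : ℕ) = t := rfl
  have h1 := h.card_cofactor_add_le (r := r) (c₁ := r) (c₂ := r') (c' := c₁) hrt hr'r.symm hrt
    (by omega) (by omega) (by omega) (by omega) (by omega)
  have h2 := h.card_cofactor_first_le_last (r := r) (c := c₀) (c' := r) (by omega) hr1 hd
  -- Shift row `t - 1` one place to the right. It gains column `t`, whose cofactor is at least those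
  -- of `t - 1` and `t - 2` together, and loses column `t - d`, whose cofactor is at most that of `t
  -- - 1`. As the cofactor of `t - 2` is positive, the permanent grows.
  have hv : Valid d (Function.update x r (t - d + 1)) := by
    intro i
    by_cases hi : i = r
    · rw [hi, Function.update_self]
      omega
    · rw [Function.update_of_ne hi]
      exact hx.1 i
  have h3 := hx.2 _ hv
  have h4 : count d x = count d (Function.update x r (t - d)) := by
    rw [show t - d = x r by omega, Function.update_eq_self]
  rw [h4, count_update, count_update] at h3
  have h5 : (univ.filter fun c : Fin n => t - d + 1 ≤ c ∧ (c : ℕ) < t - d + 1 + d) =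
      insert c₁ (univ.filter fun c : Fin n => t - d + 1 ≤ c ∧ (c : ℕ) < t) := by
    ext c
    simp only [mem_filter, mem_univ, true_and, mem_insert, Fin.ext_iff]
    omega
  have h6 : (univ.filter fun c : Fin n => t - d ≤ c ∧ (c : ℕ) < t - d + d) =
      insert c₀ (univ.filter fun c : Fin n => t - d + 1 ≤ c ∧ (c : ℕ) < t) := by
    ext c
    simp only [mem_filter, mem_univ, true_and, mem_insert, Fin.ext_iff]
    omega
  rw [h5, h6, sum_insert, sum_insert] at h3
  · omega
  · simp only [mem_filter, mem_univ, true_and]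
    omega
  · simp only [mem_filter, mem_univ, true_and]
    omega

end Gap

/-! ### Reversal -/

/-- The first columns of the rows of the matrix with the rows and columns in the reverse order. -/
def reverse {n : ℕ} (d : ℕ) (x : Fin n → ℕ) : Fin n → ℕ := fun i => n - d - x i.rev

theorem Valid.reverse {n d : ℕ} {x : Fin n → ℕ} (hx : Valid d x) : Valid d (reverse d x) := by
  intro i
  have := hx i.rev
  rw [OptimalAnticode.reverse]
  omega

theorem monotone_reverse {n d : ℕ} {x : Fin n → ℕ} (hmono : Monotone x) :
    Monotone (reverse d x) := by
  intro i j hij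
  have : x j.rev ≤ x i.rev := hmono (Fin.rev_le_rev.2 hij)
  simp only [reverse]
  omega

theorem count_le_count_reverse {n d : ℕ} {x : Fin n → ℕ} (hx : Valid d x) :
    count d x ≤ count d (reverse d x) := by
  refine card_le_card_of_injOn (fun σ => Fin.revPerm * σ * Fin.revPerm) (fun σ hσ => ?_)
    fun σ _ ρ _ h => by simpa using h
  rw [mem_coe, mem_matchings_block] at hσ ⊢
  intro i
  have h1 := hσ i.rev
  have h2 := hx i.rev
  have h3 := (σ i.rev).2
  simp only [reverse, Equiv.Perm.mul_apply, Fin.revPerm_apply, Fin.val_rev]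
  omega

theorem Optimal.reverse {n d : ℕ} {x : Fin n → ℕ} (hx : Optimal d x) :
    Optimal d (reverse d x) :=
  hx.of_count_le hx.1.reverse (count_le_count_reverse hx.1)

/-! ### Tight prefixes and suffixes of optimal matrices -/

theorem count_le_count_of_matchings {n d : ℕ} {x y : Fin n → ℕ}
    (h : ∀ σ ∈ matchings (block d x), σ ∈ matchings (block d y)) : count d x ≤ count d y :=
  card_le_card h

/-- Every matching already sends the rows `t, …, e - 1` to the columns `t, …, e - 1`. Hence the
blocks of these rows may be moved to end at `e` without losing a matching, and `Gap` applies. -/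
theorem le_card_of_tight_prefix {n d : ℕ} (hd : 0 < d) {x : Fin n → ℕ} (hx : Optimal d x)
    (hmono : Monotone x) {t e : ℕ} (ht : 0 < t) (hte : t < e) (hen : e ≤ n) (hetd : e < t + d)
    (hpre : ∀ i : Fin n, (i : ℕ) < t → x i + d ≤ t) (hsuf : ∀ i : Fin n, e ≤ (i : ℕ) → e ≤ x i) :
    d ≤ (univ.filter fun j : Fin n => (j : ℕ) < t ∧ x j + d = t).card := by
  have hdt : d ≤ t := by
    have := hpre ⟨0, by omega⟩ ht
    omega
  set y : Fin n → ℕ := fun i => if t ≤ (i : ℕ) ∧ (i : ℕ) < e then e - d else x i with hy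
  have hypre : ∀ i : Fin n, (i : ℕ) < t → y i = x i := fun i hi => if_neg (by omega)
  have hymid : ∀ i : Fin n, t ≤ (i : ℕ) → (i : ℕ) < e → y i = e - d := fun i h1 h2 =>
    if_pos ⟨h1, h2⟩
  have hysuf : ∀ i : Fin n, e ≤ (i : ℕ) → y i = x i := fun i hi => if_neg (by omega)
  have hcases : ∀ i : Fin n, ((i : ℕ) < t ∧ y i = x i ∧ x i + d ≤ t) ∨
      (t ≤ (i : ℕ) ∧ (i : ℕ) < e ∧ y i = e - d) ∨ (e ≤ (i : ℕ) ∧ y i = x i ∧ e ≤ x i) := by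
    intro i
    rcases lt_or_ge (i : ℕ) t with h1 | h1
    · exact Or.inl ⟨h1, hypre i h1, hpre i h1⟩
    rcases lt_or_ge (i : ℕ) e with h2 | h2
    · exact Or.inr (Or.inl ⟨h1, h2, hymid i h1 h2⟩)
    · exact Or.inr (Or.inr ⟨h2, hysuf i h2, hsuf i h2⟩)
  have hyv : Valid d y := by
    intro i
    have := hx.1 i
    rcases hcases i with h | h | h <;> omega
  have hymono : Monotone y := by
    intro i j hij
    have h1 : x i ≤ x j := hmono hij
    have h2 : (i : ℕ) ≤ j := hij
    rcases hcases i with h | h | h <;> rcases hcases j with h' | h' | h' <;> omega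
  have hyopt : Optimal d y := by
    refine hx.of_count_le hyv (count_le_count_of_matchings fun σ hσ => ?_)
    rw [mem_matchings_block] at hσ ⊢
    have hlt := perm_lt_iff (σ := σ) (a := t) fun i hi => by
      have h1 := hσ i
      have h2 := hpre i hi
      omega
    have hge := perm_ge_iff (σ := σ) (a := e) fun i hi => by
      have h1 := hσ i
      have h2 := hsuf i hi
      omega
    intro i
    have h1 := hσ i
    have h2 := hlt i
    have h3 := hge i
    rcases hcases i with h | h | h <;> omega
  have hgap : Gap d y t e :=
    { lt := hte
      le := hen
      lt_add := hetd
      pos := hdt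
      pre := fun i hi => by rw [hypre i hi]; exact hpre i hi
      mid := fun i h1 h2 => by rw [hymid i h1 h2]; omega
      suf := fun i hi => by rw [hysuf i hi]; exact hsuf i hi }
  refine (hgap.le_card_of_optimal hd hyopt hymono).trans (card_le_card fun j hj => ?_)
  rw [mem_filter] at hj ⊢
  rw [hypre j hj.2.1] at hj
  exact hj

theorem le_card_of_tight_suffix {n d : ℕ} (hd : 0 < d) {x : Fin n → ℕ} (hx : Optimal d x)
    (hmono : Monotone x) {t e : ℕ} (hte : t < e) (hen : e < n) (hetd : e < t + d)
    (hpre : ∀ i : Fin n, (i : ℕ) < t → x i + d ≤ t) (hsuf : ∀ i : Fin n, e ≤ (i : ℕ) → e ≤ x i) :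
    d ≤ (univ.filter fun j : Fin n => e ≤ (j : ℕ) ∧ x j = e).card := by
  have h := le_card_of_tight_prefix hd hx.reverse (monotone_reverse hmono) (t := n - e)
    (e := n - t) (by omega) (by omega) (by omega) (by omega) ?_ ?_
  · refine h.trans (card_le_card_of_injOn Fin.rev (fun j hj => ?_) Fin.rev_injective.injOn)
    rw [mem_coe, mem_filter] at hj ⊢
    simp only [mem_univ, true_and, reverse] at hj ⊢
    have h1 := hx.1 j.rev
    have h2 := Fin.val_rev j
    omega
  · intro i hi
    have h1 := hx.1 i.rev
    have h2 := Fin.val_rev i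
    have h3 := hsuf i.rev (by omega)
    rw [reverse]
    omega
  · intro i hi
    have h1 := hx.1 i.rev
    have h2 := Fin.val_rev i
    have h4 := i.2
    have h3 := hpre i.rev (by omega)
    rw [reverse]
    omega

/-- Each row has fewer than `d` copies. -/
def AllRare {n : ℕ} (d : ℕ) (x : Fin n → ℕ) : Prop :=
  ∀ v, (univ.filter fun j => x j = v).card < d

/-- The cycle that moves `a` to `b` and the elements of `(a, b]` one step down. -/
theorem exists_perm_cycle {n : ℕ} (a b : Fin n) (hab : a ≤ b) : ∃ σ : Equiv.Perm (Fin n),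
    σ a = b ∧ (∀ i, a < i → i ≤ b → (σ i : ℕ) + 1 = i) ∧ ∀ i, i < a ∨ b < i → σ i = i := by
  set f : Fin n → Fin n := fun i =>
    if i = a then b else if a < i ∧ i ≤ b then ⟨i - 1, by omega⟩ else i with hf
  have hab' : (a : ℕ) ≤ b := hab
  have hval : ∀ i : Fin n, ((i : ℕ) = a ∧ (f i : ℕ) = b) ∨
      ((a : ℕ) < i ∧ (i : ℕ) ≤ b ∧ (f i : ℕ) + 1 = i) ∨
      (((i : ℕ) < a ∨ (b : ℕ) < i) ∧ (f i : ℕ) = i) := by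
    intro i
    simp only [hf]
    split_ifs with h1 h2
    · left
      exact ⟨congrArg Fin.val h1, rfl⟩
    · right; left
      have h3 : (a : ℕ) < i := h2.1
      exact ⟨h3, h2.2, by dsimp only; omega⟩
    · right; right
      refine ⟨?_, rfl⟩
      have h3 : (i : ℕ) ≠ a := fun h => h1 (Fin.ext h)
      rw [Fin.lt_def, Fin.le_def] at h2
      omega
  have hinj : Function.Injective f := by
    intro i j hij
    have h1 : (f i : ℕ) = f j := congrArg Fin.val hij
    apply Fin.ext
    rcases hval i with h | h | h <;> rcases hval j with h' | h' | h' <;> omega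
  refine ⟨Equiv.ofBijective f (Finite.injective_iff_bijective.1 hinj), ?_, ?_, ?_⟩
  · apply Fin.ext
    rw [Equiv.ofBijective_apply]
    rcases hval a with h | h | h <;> omega
  · intro i h1 h2
    rw [Fin.lt_def] at h1
    rw [Fin.le_def] at h2
    rw [Equiv.ofBijective_apply]
    rcases hval i with h | h | h <;> omega
  · intro i h1
    rw [Fin.lt_def, Fin.lt_def] at h1
    apply Fin.ext
    rw [Equiv.ofBijective_apply]
    rcases hval i with h | h | h <;> omega

theorem le_of_tight_prefix {n d : ℕ} (hd : 0 < d) {x : Fin n → ℕ} (hx : Optimal d x)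
    (hmono : Monotone x) (hrare : AllRare d x) {s t : Fin n} (hst : (s : ℕ) + 1 = t)
    (htight : x s + d ≤ t) : (t : ℕ) ≤ x t := by
  by_contra hcross
  rw [not_le] at hcross
  have htn := t.2
  have hpos := hx.count_pos hd
  have hdiag := le_and_lt_of_monotone hmono hpos
  have hpre : ∀ i : Fin n, (i : ℕ) < t → x i + d ≤ t := by
    intro i hi
    have : x i ≤ x s := hmono (Fin.le_def.2 (by omega))
    omega
  rcases lt_or_ge n (t + d) with hn | hn
  · have h := le_card_of_tight_prefix hd hx hmono (t := t) (e := n) (by omega) htn le_rfl hn hpre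
      fun i hi => absurd i.2 (by omega)
    have h2 := hrare (t - d)
    have h3 : (univ.filter fun j : Fin n => (j : ℕ) < t ∧ x j + d = t).card ≤
        (univ.filter fun j => x j = t - d).card := by
      refine card_le_card fun j hj => ?_
      rw [mem_filter] at hj ⊢
      exact ⟨mem_univ _, by omega⟩
    omega
  -- The columns before `t` are used up by the rows before `t`, so later blocks can be pushed to
  -- start at `t` or beyond without losing a matching.
  · set y : Fin n → ℕ := fun i => if (i : ℕ) < t then x i else max (x i) t with hy
    have hcases : ∀ i : Fin n, ((i : ℕ) < t ∧ y i = x i ∧ x i + d ≤ t) ∨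
        ((t : ℕ) ≤ i ∧ y i = x i ∧ (t : ℕ) ≤ x i) ∨ ((t : ℕ) ≤ i ∧ y i = t ∧ x i < t) := by
      intro i
      rcases lt_or_ge (i : ℕ) t with h1 | h1
      · exact Or.inl ⟨h1, if_pos h1, hpre i h1⟩
      have h3 : y i = max (x i) t := if_neg (by omega)
      rcases lt_or_ge (x i) t with h2 | h2
      · exact Or.inr (Or.inr ⟨h1, by omega, h2⟩)
      · exact Or.inr (Or.inl ⟨h1, by omega, h2⟩)
    have hyv : Valid d y := by
      intro i
      have := hx.1 i
      rcases hcases i with h | h | h <;> omega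
    have hymono : Monotone y := by
      intro i j hij
      have h1 : x i ≤ x j := hmono hij
      have h2 : (i : ℕ) ≤ j := hij
      rcases hcases i with h | h | h <;> rcases hcases j with h' | h' | h' <;> omega
    have hsub : ∀ σ ∈ matchings (block d x), σ ∈ matchings (block d y) := by
      intro σ hσ
      rw [mem_matchings_block] at hσ ⊢
      have hlt := perm_lt_iff (σ := σ) (a := t) fun i hi => by
        have h1 := hσ i
        have h2 := hpre i hi
        omega
      intro i
      have h1 := hσ i
      have h2 := hlt i
      rcases hcases i with h | h | h <;> omega
    have hyopt := hx.of_count_le hyv (count_le_count_of_matchings hsub)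
    have hydiag := le_and_lt_of_monotone hymono (hyopt.count_pos hd)
    -- If such an `i` exists, the rows from `i` on form a tight suffix and `d` rows start at `i`,
    -- against rarity. If not, each row strictly between `t` and `t + d` can step back one column,
    -- which frees column `t + d - 1` for row `t`: a matching of `y` that `x` does not have.
    by_cases hex : ∃ i : Fin n, (t : ℕ) < i ∧ (i : ℕ) < t + d ∧ (i : ℕ) ≤ y i
    · obtain ⟨i, hti, hitd, hiy⟩ := hex
      have h := le_card_of_tight_suffix hd hyopt hymono (t := t) (e := i) hti i.2 hitd
        (fun j hj => by rcases hcases j with h | h | h <;> omega)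
        (fun j hj => by
          have : y i ≤ y j := hymono hj
          omega)
      have h2 := hrare i
      have h3 : (univ.filter fun j : Fin n => (i : ℕ) ≤ j ∧ y j = i).card ≤
          (univ.filter fun j => x j = i).card := by
        refine card_le_card fun j hj => ?_
        rw [mem_filter] at hj ⊢
        refine ⟨mem_univ _, ?_⟩
        rcases hcases j with h | h | h <;> omega
      omega
    · push Not at hex
      obtain ⟨σ, hσ1, hσ2, hσ3⟩ := exists_perm_cycle t ⟨t + d - 1, by omega⟩
        (Fin.le_def.2 (by dsimp only; omega))
      have hσy : σ ∈ matchings (block d y) := by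
        rw [mem_matchings_block]
        intro i
        have h0 := hydiag i
        rcases lt_trichotomy (i : ℕ) t with h1 | h1 | h1
        · rw [hσ3 i (Or.inl h1)]
          exact h0
        · obtain rfl : i = t := Fin.ext h1
          rw [hσ1]
          rcases hcases i with h | h | h <;> dsimp only <;> omega
        · rcases lt_or_ge (i : ℕ) (t + d) with h2 | h2
          · have h3 := hσ2 i h1 (Fin.le_def.2 (by dsimp only; omega))
            have h4 := hex i h1 h2
            omega
          · rw [hσ3 i (Or.inr (Fin.lt_def.2 (by dsimp only; omega)))]
            exact h0
      have hσx : σ ∉ matchings (block d x) := by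
        rw [mem_matchings_block]
        intro h
        have h1 := h t
        rw [hσ1] at h1
        dsimp only at h1
        omega
      have hlt : count d x < count d y :=
        card_lt_card ((ssubset_iff_of_subset hsub).2 ⟨σ, hσy, hσx⟩)
      exact absurd (hx.2 y hyv) (by omega)

theorem le_of_tight_suffix {n d : ℕ} (hd : 0 < d) {x : Fin n → ℕ} (hx : Optimal d x)
    (hmono : Monotone x) (hrare : AllRare d x) {s t : Fin n} (hst : (s : ℕ) + 1 = t)
    (htight : (t : ℕ) ≤ x t) : x s + d ≤ t := by
  have ht := hx.1 t
  have hs := hx.1 s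
  have h1 := Fin.val_rev t
  have h2 := Fin.val_rev s
  have hrare' : AllRare d (reverse d x) := by
    intro v
    refine lt_of_le_of_lt ?_ (hrare (n - d - v))
    refine card_le_card_of_injOn Fin.rev (fun j hj => ?_) Fin.rev_injective.injOn
    rw [mem_coe, mem_filter] at hj ⊢
    simp only [mem_univ, true_and, reverse] at hj ⊢
    have := hx.1 j.rev
    omega
  have h := le_of_tight_prefix hd hx.reverse (monotone_reverse hmono) hrare' (s := t.rev)
    (t := s.rev) (by omega) (by rw [reverse, Fin.rev_rev]; omega)
  rw [reverse, Fin.rev_rev] at h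
  omega

/-! ### Connected sorted matrices -/

/-- The matrix of `x` is not a direct sum of two matrices of consecutive rows and columns. -/
def NoCut {n : ℕ} (d : ℕ) (x : Fin n → ℕ) : Prop :=
  ∀ s t : Fin n, (s : ℕ) + 1 = t → ¬ (x s + d ≤ t ∧ (t : ℕ) ≤ x t)

/-- The diagonal is all ones, so the rows and columns of a zero submatrix of this size have
complementary index sets. By the absence of cuts and the tightness lemmas the entries next to the
diagonal are ones as well, so the row set is closed under passing to a neighbour and is therefore
empty or everything. -/
theorem fullyIndecomposable_of_noCut {n d : ℕ} (hd : 0 < d) (hn : 0 < n) {x : Fin n → ℕ}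
    (hx : Optimal d x) (hmono : Monotone x) (hrare : AllRare d x) (hcut : NoCut d x) :
    FullyIndecomposable (blockMatrix d x) := by
  have hdiag := le_and_lt_of_monotone hmono (hx.count_pos hd)
  have hone : ∀ i j : Fin n, x i ≤ j → (j : ℕ) < x i + d → blockMatrix d x i j ≠ 0 := by
    intro i j h1 h2
    rw [blockMatrix_apply, if_pos (mem_block.2 ⟨h1, h2⟩)]
    exact one_ne_zero
  constructor
  · intro h0
    have h1 := hdiag ⟨0, hn⟩
    refine hone ⟨0, hn⟩ ⟨0, hn⟩ h1.1 h1.2 ?_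
    rw [h0]
    rfl
  · intro R T hR hT hcard
    by_contra hzero
    push Not at hzero
    have hz : ∀ i ∈ R, ∀ j : Fin n, x i ≤ j → (j : ℕ) < x i + d → j ∉ T := fun i hi j h1 h2 hj =>
      hone i j h1 h2 (hzero i hi j hj)
    have hdisj : Disjoint R T := disjoint_left.2 fun i hi => hz i hi i (hdiag i).1 (hdiag i).2
    have hunion : R ∪ T = univ := by
      rw [← card_eq_iff_eq_univ, card_union_of_disjoint hdisj, hcard, Fintype.card_fin]
    have hmem : ∀ i, i ∉ T → i ∈ R := by
      intro i hi
      have : i ∈ R ∪ T := by rw [hunion]; exact mem_univ i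
      exact (mem_union.1 this).resolve_right hi
    have hup : ∀ s t : Fin n, (s : ℕ) + 1 = t → s ∈ R → t ∈ R := by
      intro s t hst hs
      refine hmem t (hz s hs t ?_ ?_)
      · have := (hdiag s).1
        omega
      · by_contra hge
        have h1 : x s + d ≤ t := by omega
        exact hcut s t hst ⟨h1, le_of_tight_prefix hd hx hmono hrare hst h1⟩
    have hdown : ∀ s t : Fin n, (s : ℕ) + 1 = t → t ∈ R → s ∈ R := by
      intro s t hst ht
      refine hmem s (hz t ht s ?_ ?_)
      · by_contra hge
        have h1 : (t : ℕ) ≤ x t := by omega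
        exact hcut s t hst ⟨le_of_tight_suffix hd hx hmono hrare hst h1, h1⟩
      · have := (hdiag t).2
        omega
    have hzeroR : ∀ k (hk : k < n), (⟨k, hk⟩ : Fin n) ∈ R ↔ (⟨0, hn⟩ : Fin n) ∈ R := by
      intro k
      induction k with
      | zero => exact fun _ => Iff.rfl
      | succ k ih =>
        intro hk
        rw [← ih (by omega)]
        exact ⟨hdown ⟨k, by omega⟩ ⟨k + 1, hk⟩ rfl, hup ⟨k, by omega⟩ ⟨k + 1, hk⟩ rfl⟩
    obtain ⟨i, hi⟩ := hR
    obtain ⟨j, hj⟩ := hT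
    exact disjoint_left.1 hdisj ((hzeroR j j.2).2 ((hzeroR i i.2).1 hi)) hj

theorem bipGraph_connected_of_noCut {n d : ℕ} (hn : 0 < n) {x : Fin n → ℕ}
    (hmono : Monotone x) (hpos : 0 < count d x) (hcut : NoCut d x) :
    (bipGraph (blockMatrix d x)).Connected := by
  have hdiag := le_and_lt_of_monotone hmono hpos
  have hadj : ∀ i j : Fin n, x i ≤ j → (j : ℕ) < x i + d →
      (bipGraph (blockMatrix d x)).Reachable (Sum.inl i) (Sum.inr j) := by
    intro i j h1 h2
    refine SimpleGraph.Adj.reachable ?_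
    rw [bipGraph, SimpleGraph.fromRel_adj]
    refine ⟨Sum.inl_ne_inr, Or.inl ⟨i, j, rfl, rfl, ?_⟩⟩
    rw [blockMatrix_apply, if_pos (mem_block.2 ⟨h1, h2⟩)]
  have hrow : ∀ k (hk : k < n),
      (bipGraph (blockMatrix d x)).Reachable (Sum.inl ⟨0, hn⟩) (Sum.inl ⟨k, hk⟩) := by
    intro k
    induction k with
    | zero => exact fun _ => SimpleGraph.Reachable.refl _
    | succ k ih =>
      intro hk
      have h1 := ih (by omega)
      have h2 := hdiag ⟨k, by omega⟩
      have h3 := hdiag ⟨k + 1, hk⟩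
      have h4 := hcut ⟨k, by omega⟩ ⟨k + 1, hk⟩ rfl
      dsimp only at h2 h3 h4
      rcases lt_or_ge (k + 1) (x ⟨k, by omega⟩ + d) with h5 | h5
      · exact (h1.trans (hadj ⟨k, by omega⟩ ⟨k + 1, hk⟩ (by dsimp only; omega) h5)).trans
          (hadj ⟨k + 1, hk⟩ ⟨k + 1, hk⟩ h3.1 h3.2).symm
      · exact (h1.trans (hadj ⟨k, by omega⟩ ⟨k, by omega⟩ h2.1 h2.2)).trans
          (hadj ⟨k + 1, hk⟩ ⟨k, by omega⟩ (by dsimp only; omega) (by dsimp only; omega)).symm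
  rw [SimpleGraph.connected_iff_exists_forall_reachable]
  refine ⟨Sum.inl ⟨0, hn⟩, ?_⟩
  rintro (i | i)
  · exact hrow i i.2
  · exact (hrow i i.2).trans (hadj i i (hdiag i).1 (hdiag i).2)

/-- If no row were mixed in the identity matching, neighbouring rows, one of which meets the other's
diagonal column, would coincide. All blocks would be equal and cover every column, forcing `n = d`.
-/
theorem mixedPairs_nonempty_of_noCut {n d : ℕ} (hn : 0 < n) (hne : n ≠ d)
    {x : Fin n → ℕ} (hx : Valid d x) (hmono : Monotone x) (hpos : 0 < count d x)
    (hcut : NoCut d x) : (mixedPairs (block d x)).Nonempty := by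
  have hdiag := le_and_lt_of_monotone hmono hpos
  by_contra hempty
  rw [not_nonempty_iff_eq_empty] at hempty
  have hsame : ∀ i k : Fin n, k ∈ block d x i → block d x k = block d x i := by
    intro i k hk
    by_contra hki
    have : ((1 : Equiv.Perm (Fin n)), i) ∈ mixedPairs (block d x) := by
      rw [mixedPairs, mem_filter, mem_product]
      exact ⟨⟨one_mem_matchings_of_monotone hmono hpos, mem_univ _⟩, k, hk, hki⟩
    rw [hempty] at this
    exact notMem_empty _ this
  have hall : ∀ k (hk : k < n), block d x ⟨k, hk⟩ = block d x ⟨0, hn⟩ := by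
    intro k
    induction k with
    | zero => exact fun _ => rfl
    | succ k ih =>
      intro hk
      have h1 := ih (by omega)
      have h2 := hdiag ⟨k, by omega⟩
      have h3 := hdiag ⟨k + 1, hk⟩
      have h4 := hcut ⟨k, by omega⟩ ⟨k + 1, hk⟩ rfl
      dsimp only at h2 h3 h4
      rw [← h1]
      rcases lt_or_ge (k + 1) (x ⟨k, by omega⟩ + d) with h5 | h5
      · exact hsame _ _ (mem_block.2 ⟨by dsimp only; omega, h5⟩)
      · exact (hsame _ _ (mem_block.2 ⟨by dsimp only; omega, by dsimp only; omega⟩)).symm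
  have huniv : block d x ⟨0, hn⟩ = univ := by
    ext i
    simp only [mem_univ, iff_true]
    rw [← hall i i.2]
    exact mem_block.2 (hdiag i)
  have := card_block hx ⟨0, hn⟩
  rw [huniv, card_univ, Fintype.card_fin] at this
  exact hne this

/-! ### Decomposition into connected matrices -/

theorem Iso.trans {I J K : Type*} {A : Matrix I I ℕ} {B : Matrix J J ℕ} {C : Matrix K K ℕ}
    (h₁ : Iso A B) (h₂ : Iso B C) : Iso A C := by
  obtain ⟨e, f, rfl⟩ := h₁
  obtain ⟨e', f', rfl⟩ := h₂
  exact ⟨e.trans e', f.trans f', rfl⟩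

theorem blockMatrix_glue {k l d : ℕ} {x₁ : Fin k → ℕ} (h₁ : Valid d x₁) (x₂ : Fin l → ℕ) :
    (blockMatrix d (glue x₁ x₂)).submatrix finSumFinEquiv finSumFinEquiv =
      Matrix.fromBlocks (blockMatrix d x₁) 0 0 (blockMatrix d x₂) := by
  ext (i | i) (j | j)
  · simp [blockMatrix]
  · have := h₁ i
    simp only [Matrix.submatrix_apply, finSumFinEquiv_apply_left, finSumFinEquiv_apply_right,
      blockMatrix, Matrix.of_apply, glue_castAdd, Fin.val_natAdd, Matrix.fromBlocks_apply₁₂,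
      Matrix.zero_apply]
    exact if_neg (by omega)
  · have := j.2
    simp only [Matrix.submatrix_apply, finSumFinEquiv_apply_left, finSumFinEquiv_apply_right,
      blockMatrix, Matrix.of_apply, glue_natAdd, Fin.val_castAdd, Matrix.fromBlocks_apply₂₁,
      Matrix.zero_apply]
    exact if_neg (by omega)
  · simp [blockMatrix, add_assoc]

/-- The permanent of a direct sum is the product, so improving one summand improves the whole. -/
theorem Optimal.of_glue {k l d : ℕ} (hd : 0 < d) {x₁ : Fin k → ℕ} {x₂ : Fin l → ℕ}
    (h₁ : Valid d x₁) (h₂ : Valid d x₂) (h : Optimal d (glue x₁ x₂)) :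
    Optimal d x₁ ∧ Optimal d x₂ := by
  have hpos := h.count_pos hd
  rw [count_glue h₁] at hpos
  refine ⟨⟨h₁, fun y hy => ?_⟩, ⟨h₂, fun y hy => ?_⟩⟩
  · have := h.2 _ (hy.glue h₂)
    rw [count_glue hy, count_glue h₁] at this
    exact Nat.le_of_mul_le_mul_right this (Nat.pos_of_mul_pos_left hpos)
  · have := h.2 _ (h₁.glue hy)
    rw [count_glue h₁, count_glue h₁] at this
    exact Nat.le_of_mul_le_mul_left this (Nat.pos_of_mul_pos_right hpos)

theorem exists_eq_glue {k l d : ℕ} {x : Fin (k + l) → ℕ} (hx : Valid d x) (hmono : Monotone x)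
    (hpre : ∀ i : Fin (k + l), (i : ℕ) < k → x i + d ≤ k)
    (hsuf : ∀ i : Fin (k + l), k ≤ (i : ℕ) → k ≤ x i) :
    ∃ (x₁ : Fin k → ℕ) (x₂ : Fin l → ℕ), x = glue x₁ x₂ ∧ Valid d x₁ ∧ Valid d x₂ ∧
      Monotone x₁ ∧ Monotone x₂ := by
  refine ⟨fun i => x (Fin.castAdd l i), fun j => x (Fin.natAdd k j) - k, ?_, ?_, ?_, ?_, ?_⟩
  · funext i
    refine Fin.addCases (fun i => ?_) (fun i => ?_) i
    · rw [glue_castAdd]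
    · rw [glue_natAdd]
      have := hsuf (Fin.natAdd k i) (by simp)
      omega
  · exact fun i => hpre _ (by simp)
  · intro j
    have h1 := hx (Fin.natAdd k j)
    have h2 := hsuf (Fin.natAdd k j) (by simp)
    dsimp only
    omega
  · intro i j hij
    exact hmono (Fin.le_def.2 (by simpa using hij))
  · intro i j hij
    have : x (Fin.natAdd k i) ≤ x (Fin.natAdd k j) := hmono (Fin.le_def.2 (by simpa using hij))
    dsimp only
    omega

/-- A decomposition of the matrix of `x` into connected optimal matrices with sorted rows. -/
structure Decomposition {n : ℕ} (d : ℕ) (x : Fin n → ℕ) where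
  /-- The index type of the summands. -/
  J : Type
  fintype : Fintype J
  decEq : DecidableEq J
  /-- The orders of the summands. -/
  m : J → ℕ
  /-- The first columns of the rows of the summands. -/
  X : ∀ j, Fin (m j) → ℕ
  pos : ∀ j, 0 < m j
  optimal : ∀ j, Optimal d (X j)
  monotone : ∀ j, Monotone (X j)
  noCut : ∀ j, NoCut d (X j)
  sum_eq : ∑ j, m j = n
  prod_eq : ∏ j, count d (X j) = count d x
  iso : Iso (blockMatrix d x) (Matrix.blockDiagonal' fun j => blockMatrix d (X j))

attribute [instance] Decomposition.fintype Decomposition.decEq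

theorem iso_blockDiagonal'_sum {J₁ J₂ : Type} [DecidableEq J₁] [DecidableEq J₂] {m : J₁ ⊕ J₂ → ℕ}
    (C : ∀ j, Matrix (Fin (m j)) (Fin (m j)) ℕ) {I₁ I₂ : Type*} {A₁ : Matrix I₁ I₁ ℕ}
    {A₂ : Matrix I₂ I₂ ℕ} (h₁ : Iso A₁ (Matrix.blockDiagonal' fun j => C (Sum.inl j)))
    (h₂ : Iso A₂ (Matrix.blockDiagonal' fun j => C (Sum.inr j))) :
    Iso (Matrix.fromBlocks A₁ 0 0 A₂) (Matrix.blockDiagonal' C) := by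
  obtain ⟨e₁, f₁, rfl⟩ := h₁
  obtain ⟨e₂, f₂, rfl⟩ := h₂
  refine ⟨(Equiv.sumCongr e₁ e₂).trans (Equiv.sumSigmaDistrib fun j => Fin (m j)).symm,
    (Equiv.sumCongr f₁ f₂).trans (Equiv.sumSigmaDistrib fun j => Fin (m j)).symm, ?_⟩
  ext (i | i) (j | j)
  · simp only [Matrix.submatrix_apply, Equiv.trans_apply, Equiv.sumCongr_apply, Sum.map_inl,
      Equiv.sumSigmaDistrib_symm_apply, Sum.elim_inl, Matrix.fromBlocks_apply₁₁]
    by_cases h : (e₁ i).1 = (f₁ j).1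
    · simp [Matrix.blockDiagonal'_apply, h]
    · simp [Matrix.blockDiagonal'_apply, h]
  · simp [Matrix.blockDiagonal'_apply]
  · simp [Matrix.blockDiagonal'_apply]
  · simp only [Matrix.submatrix_apply, Equiv.trans_apply, Equiv.sumCongr_apply, Sum.map_inr,
      Equiv.sumSigmaDistrib_symm_apply, Sum.elim_inr, Matrix.fromBlocks_apply₂₂]
    by_cases h : (e₂ i).1 = (f₂ j).1
    · simp [Matrix.blockDiagonal'_apply, h]
    · simp [Matrix.blockDiagonal'_apply, h]

theorem iso_blockDiagonal'_unique {J : Type} [Unique J] [DecidableEq J] {n : ℕ}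
    (A : Matrix (Fin n) (Fin n) ℕ) : Iso A (Matrix.blockDiagonal' fun _ : J => A) := by
  refine ⟨(Equiv.uniqueSigma fun _ : J => Fin n).symm, (Equiv.uniqueSigma fun _ : J => Fin n).symm,
    ?_⟩
  ext i j
  simp [Matrix.blockDiagonal'_apply, Equiv.uniqueSigma]

theorem nonempty_decomposition {d : ℕ} (hd : 0 < d) (n : ℕ) (x : Fin n → ℕ) (hx : Optimal d x)
    (hmono : Monotone x) : Nonempty (Decomposition d x) := by
  induction n using Nat.strong_induction_on with
  | _ n ih =>
    rcases Nat.eq_zero_or_pos n with rfl | hn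
    · exact ⟨{
        J := Empty
        fintype := inferInstance
        decEq := inferInstance
        m := Empty.elim
        X := fun j => j.elim
        pos := fun j => j.elim
        optimal := fun j => j.elim
        monotone := fun j => j.elim
        noCut := fun j => j.elim
        sum_eq := rfl
        prod_eq := by
          have : matchings (block d x) = univ := by
            ext σ
            simp [mem_matchings_block, Subsingleton.elim σ 1]
          rw [count, this]
          rfl
        iso := ⟨Equiv.equivOfIsEmpty _ _, Equiv.equivOfIsEmpty _ _, by ext i; exact i.elim0⟩ }⟩
    by_cases hcut : NoCut d x
    · exact ⟨{
        J := Unit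
        fintype := inferInstance
        decEq := inferInstance
        m := fun _ => n
        X := fun _ => x
        pos := fun _ => hn
        optimal := fun _ => hx
        monotone := fun _ => hmono
        noCut := fun _ => hcut
        sum_eq := by simp
        prod_eq := by simp
        iso := iso_blockDiagonal'_unique _ }⟩
    · simp only [NoCut, not_forall, not_not] at hcut
      obtain ⟨s, t, hst, h1, h2⟩ := hcut
      obtain ⟨k, hk⟩ : ∃ k, k = (t : ℕ) := ⟨_, rfl⟩
      have htn := t.2
      obtain ⟨l, rfl⟩ := Nat.exists_eq_add_of_le (show k ≤ n by omega)
      obtain ⟨x₁, x₂, rfl, hv₁, hv₂, hm₁, hm₂⟩ := exists_eq_glue (l := l) hx.1 hmono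
        (fun i hi => by
          have : x i ≤ x s := hmono (Fin.le_def.2 (by omega))
          omega)
        (fun i hi => by
          have : x t ≤ x i := hmono (Fin.le_def.2 (by omega))
          omega)
      obtain ⟨ho₁, ho₂⟩ := Optimal.of_glue hd hv₁ hv₂ hx
      obtain ⟨D₁⟩ := ih k (by omega) x₁ ho₁ hm₁
      obtain ⟨D₂⟩ := ih l (by omega) x₂ ho₂ hm₂
      let X : ∀ j : D₁.J ⊕ D₂.J, Fin (Sum.elim D₁.m D₂.m j) → ℕ := fun j =>
        match j with
        | Sum.inl j => D₁.X j
        | Sum.inr j => D₂.X j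
      exact ⟨{
        J := D₁.J ⊕ D₂.J
        fintype := inferInstance
        decEq := inferInstance
        m := Sum.elim D₁.m D₂.m
        X := X
        pos := by
          rintro (j | j)
          · exact D₁.pos j
          · exact D₂.pos j
        optimal := by
          rintro (j | j)
          · exact D₁.optimal j
          · exact D₂.optimal j
        monotone := by
          rintro (j | j)
          · exact D₁.monotone j
          · exact D₂.monotone j
        noCut := by
          rintro (j | j)
          · exact D₁.noCut j
          · exact D₂.noCut j
        sum_eq := by
          rw [Fintype.sum_sum_type]
          exact congrArg₂ _ D₁.sum_eq D₂.sum_eq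
        prod_eq := by
          rw [Fintype.prod_sum_type, count_glue hv₁]
          exact congrArg₂ _ D₁.prod_eq D₂.prod_eq
        iso := by
          refine Iso.trans ?_ (iso_blockDiagonal'_sum (fun j => blockMatrix d (X j)) D₁.iso D₂.iso)
          refine ⟨finSumFinEquiv.symm, finSumFinEquiv.symm, ?_⟩
          rw [← blockMatrix_glue hv₁]
          simp }⟩

/-! ### The number of summands of order other than `d` -/

/-- Some matrix in `Γ_n^d` has the permanent `P`. -/
def Realizable (d n P : ℕ) : Prop := ∃ y : Fin n → ℕ, Valid d y ∧ count d y = P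

theorem Realizable.add {d n n' P P' : ℕ} (h : Realizable d n P) (h' : Realizable d n' P') :
    Realizable d (n + n') (P * P') := by
  obtain ⟨y, hy, rfl⟩ := h
  obtain ⟨y', hy', rfl⟩ := h'
  exact ⟨glue y y', hy.glue hy', count_glue hy y'⟩

theorem realizable_zero (d : ℕ) : Realizable d 0 1 := by
  refine ⟨Fin.elim0, fun i => i.elim0, ?_⟩
  rw [count, card_eq_one]
  exact ⟨1, by ext σ; simp [mem_matchings_block, Subsingleton.elim σ 1]⟩

theorem realizable_mul (d q : ℕ) : Realizable d (q * d) (d.factorial ^ q) := by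
  induction q with
  | zero => simpa using realizable_zero d
  | succ q ih =>
    rw [Nat.succ_mul, pow_succ]
    exact ih.add ⟨fun _ => 0, fun _ => by simp, count_zero⟩

theorem realizable_sum {J : Type*} (S : Finset J) {d : ℕ} {m : J → ℕ} {P : J → ℕ}
    (h : ∀ j, Realizable d (m j) (P j)) : Realizable d (∑ j ∈ S, m j) (∏ j ∈ S, P j) := by
  classical
  induction S using Finset.induction_on with
  | empty => simpa using realizable_zero d
  | insert j S hj ih =>
    rw [sum_insert hj, prod_insert hj]
    exact (h j).add ih

/-- Two of `d + 1` partial sums agree modulo `d`; their difference is the sum over a nonempty set.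
-/
theorem exists_subset_dvd_sum {J : Type*} {d : ℕ} (hd : 0 < d) (T : Finset J) (hT : d ≤ T.card)
    (f : J → ℕ) : ∃ S ⊆ T, S.Nonempty ∧ d ∣ ∑ j ∈ S, f j := by
  classical
  obtain ⟨j₀, hj₀⟩ := card_pos.1 (hd.trans_le hT)
  -- An enumeration of `T`; the default `j₀` is not reached in the sums below, which use only
  -- indices less than `d`.
  let g : ℕ → J := fun k => if h : k < T.card then (T.equivFin.symm ⟨k, h⟩ : J) else j₀
  have hgT : ∀ k, g k ∈ T := by
    intro k
    simp only [g]
    split_ifs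
    · exact coe_mem _
    · exact hj₀
  have hg : ∀ k < T.card, ∀ l < T.card, g k = g l → k = l := by
    intro k hk l hl h
    simp only [g, dif_pos hk, dif_pos hl] at h
    simpa using T.equivFin.symm.injective (Subtype.ext h)
  obtain ⟨k, hk, l, hl, hne, heq⟩ := exists_ne_map_eq_of_card_lt_of_maps_to
    (s := range (d + 1)) (t := range d) (f := fun k => (∑ i ∈ range k, f (g i)) % d) (by simp)
    (fun k _ => by simpa using Nat.mod_lt _ hd)
  wlog hkl : k < l generalizing k l
  · exact this l hl k hk hne.symm heq.symm (by omega)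
  rw [mem_range] at hk hl
  refine ⟨(Ico k l).image g, ?_, ?_, ?_⟩
  · intro j hj
    obtain ⟨i, -, rfl⟩ := mem_image.1 hj
    exact hgT i
  · exact ⟨g k, mem_image_of_mem _ (by simpa using hkl)⟩
  · rw [sum_image]
    · have hsum := sum_range_add_sum_Ico (fun i => f (g i)) hkl.le
      rw [← hsum] at heq
      have := (Nat.modEq_iff_dvd' (Nat.le_add_right _ _)).1 heq
      rwa [Nat.add_sub_cancel_left] at this
    · intro i hi j hj h
      rw [mem_coe, mem_Ico] at hi hj
      exact hg i (by omega) j (by omega) h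

/-- From `d` such summands choose some of total order `d * q`. The `d`-th power of their joint
permanent is less than `d!^(d * q)`, so `q` all-ones blocks in their place would do better. -/
theorem Decomposition.card_ne_le {n d : ℕ} (hd : 0 < d) {x : Fin n → ℕ} (hx : Optimal d x)
    (D : Decomposition d x) :
    (univ.filter fun j => D.m j ≠ d).card ≤ d - 1 := by
  classical
  by_contra hcard
  obtain ⟨S, hS, hSne, q, hq⟩ := exists_subset_dvd_sum hd (univ.filter fun j => D.m j ≠ d)
    (by omega) D.m
  have hpos : ∀ j, 0 < count d (D.X j) := fun j => (D.optimal j).count_pos hd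
  have hcomp := (realizable_mul d q).add
    (realizable_sum Sᶜ fun j => ⟨D.X j, (D.optimal j).1, rfl⟩)
  have hn : q * d + ∑ j ∈ Sᶜ, D.m j = n := by
    rw [mul_comm, ← hq, sum_add_sum_compl]
    exact D.sum_eq
  rw [hn] at hcomp
  obtain ⟨y, hy, hycount⟩ := hcomp
  have hle := hx.2 y hy
  rw [hycount, ← D.prod_eq, ← prod_mul_prod_compl S] at hle
  have hle' := Nat.le_of_mul_le_mul_right hle (prod_pos fun j _ => hpos j)
  have hlt : ∏ j ∈ S, count d (D.X j) ^ d < ∏ j ∈ S, d.factorial ^ D.m j := by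
    refine prod_lt_prod_of_nonempty (fun j _ => pow_pos (hpos j) d) (fun j hj => ?_) hSne
    exact count_pow_lt hd (D.optimal j).1 (mixedPairs_nonempty_of_noCut (D.pos j)
      (mem_filter.1 (hS hj)).2 (D.optimal j).1 (D.monotone j) (hpos j) (D.noCut j))
  rw [prod_pow, prod_pow_eq_pow_sum, hq] at hlt
  have := Nat.pow_le_pow_left hle' d
  rw [← pow_mul, mul_comm q d] at this
  omega

/-! ### Separation of the all-ones summands -/

theorem blockMatrix_eq_one {n d : ℕ} {x : Fin n → ℕ} (hx : Valid d x) (hn : n = d)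
    (i j : Fin n) : blockMatrix d x i j = 1 := by
  have h1 := hx i
  have h2 := j.2
  rw [blockMatrix_apply, if_pos (mem_block.2 ⟨by omega, by omega⟩)]

theorem iso_onesSum {J : Type} [DecidableEq J] {d a h : ℕ} {m : J → ℕ}
    (C : ∀ j, Matrix (Fin (m j)) (Fin (m j)) ℕ) (p : Fin a ≃ {j // m j = d})
    (q : Fin h ≃ {j // m j ≠ d}) (hC : ∀ j, m j = d → ∀ u v, C j u v = 1) :
    Iso (Matrix.blockDiagonal' C) (onesSum d a (fun i => m (q i)) fun i => C (q i)) := by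
  let G : (Fin d × Fin a) ⊕ (Σ i, Fin (m (q i))) → Σ j, Fin (m j) := Sum.elim
    (fun z => ⟨p z.2, Fin.cast (p z.2).2.symm z.1⟩) fun z => ⟨q z.1, z.2⟩
  have hpq : ∀ k i, (p k : J) ≠ q i := fun k i hh => (q i).2 (by rw [← hh]; exact (p k).2)
  have hp : ∀ k k', (p k : J) = p k' ↔ k = k' := fun k k' => by
    rw [← Subtype.ext_iff, p.injective.eq_iff]
  have hq : ∀ i i', (q i : J) = q i' ↔ i = i' := fun i i' => by
    rw [← Subtype.ext_iff, q.injective.eq_iff]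
  have hinj : Function.Injective G := by
    rintro (⟨u, k⟩ | ⟨i, u⟩) (⟨u', k'⟩ | ⟨i', u'⟩) hh
    · simp only [G, Sum.elim_inl] at hh
      obtain rfl := (hp k k').1 (congrArg Sigma.fst hh)
      simpa using hh
    · exact absurd (congrArg Sigma.fst hh) (hpq k i')
    · exact absurd (congrArg Sigma.fst hh).symm (hpq k' i)
    · simp only [G, Sum.elim_inr] at hh
      obtain rfl := (hq i i').1 (congrArg Sigma.fst hh)
      simpa using hh
  have hsurj : Function.Surjective G := by
    rintro ⟨j, u⟩
    by_cases hj : m j = d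
    · obtain ⟨k, hk⟩ := p.surjective ⟨j, hj⟩
      obtain rfl : (p k : J) = j := by rw [hk]
      exact ⟨Sum.inl (Fin.cast hj u, k), rfl⟩
    · obtain ⟨i, hi⟩ := q.surjective ⟨j, hj⟩
      obtain rfl : (q i : J) = j := by rw [hi]
      exact ⟨Sum.inr ⟨i, u⟩, rfl⟩
  let E := Equiv.ofBijective G ⟨hinj, hsurj⟩
  refine ⟨E.symm, E.symm, ?_⟩
  suffices hE : onesSum d a (fun i => m (q i)) (fun i => C (q i)) =
      (Matrix.blockDiagonal' C).submatrix E E by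
    rw [hE]
    simp
  ext r c
  change _ = Matrix.blockDiagonal' C (G r) (G c)
  rcases r with ⟨u, k⟩ | ⟨i, u⟩ <;> rcases c with ⟨u', k'⟩ | ⟨i', u'⟩
  · by_cases hk : k = k'
    · subst hk
      simp [onesSum, G, allOnes, hC _ (p k).2]
    · simp [onesSum, G, Matrix.blockDiagonal_apply, Matrix.blockDiagonal'_apply, hk, hp]
  · simp [onesSum, G, Matrix.blockDiagonal'_apply, hpq]
  · simp [onesSum, G, Matrix.blockDiagonal'_apply, (hpq _ _).symm]
  · by_cases hi : i = i'
    · subst hi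
      simp [onesSum, G]
    · simp [onesSum, G, Matrix.blockDiagonal'_apply, hi, hq]

/-! ### The main theorem -/

theorem allRare_of_not_containsOnes {n d : ℕ} (hd : 0 < d) {x : Fin n → ℕ} (hx : Valid d x)
    (h : ¬ ContainsOnes d (blockMatrix d x)) : AllRare d x := by
  intro v
  by_contra hv
  rw [not_lt] at hv
  obtain ⟨i, hi⟩ := card_pos.1 (hd.trans_le hv)
  refine h (containsOnes_of_card hv (card_block hx i).ge fun u hu w hw => ?_)
  rw [mem_filter] at hi hu
  rw [mem_block] at hw
  rw [blockMatrix_apply, if_pos (mem_block.2 (by rw [hu.2, ← hi.2]; exact hw))]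

/-- Nonemptiness is essential: `sInf` of the empty set would be the default value `0`. -/
theorem isLeast_bStar {d : ℕ} (hd : 0 < d) : IsLeast (componentBounds d) (bStar d) :=
  ⟨Nat.sInf_mem (componentBounds_nonempty hd), fun _ hb => Nat.sInf_le hb⟩

/-- The summand is itself an optimal matrix with a single component, so the bound defining `b*_d`
applies to it directly. -/
theorem le_bStar_of_noCut {n d : ℕ} (hd : 0 < d) (hn : 0 < n) {x : Fin n → ℕ} (hx : Optimal d x)
    (hmono : Monotone x) (hcut : NoCut d x) (h : ¬ ContainsOnes d (blockMatrix d x)) :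
    n ≤ bStar d :=
  (isLeast_bStar hd).1 n _ ((blockMatrix_mem_Opt_iff hx.1).2 hx) 1 (fun _ => n)
    (fun _ => blockMatrix d x)
    ⟨iso_blockDiagonal'_unique _, fun _ => fullyIndecomposable_of_noCut hd hn hx hmono
      (allRare_of_not_containsOnes hd hx.1 h) hcut⟩ 0 h

end OptimalAnticode

theorem theorem3p7 (d n : ℕ) (hd : 0 < d) (hdn : d ≤ n) (A : Matrix (Fin n) (Fin n) ℕ)
    (hA : A ∈ OptimalAnticode.Opt n d) :
    IsLeast (OptimalAnticode.componentBounds d) (OptimalAnticode.bStar d) ∧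
    ∃ (a h : ℕ) (m : Fin h → ℕ) (C : ∀ i, Matrix (Fin (m i)) (Fin (m i)) ℕ),
      h ≤ d - 1 ∧
      OptimalAnticode.Iso A (OptimalAnticode.onesSum d a m C) ∧
      ∀ i, (OptimalAnticode.bipGraph (C i)).Connected ∧
        C i ∈ OptimalAnticode.Opt (m i) d ∧
        (¬ OptimalAnticode.ContainsOnes d (C i) → m i ≤ OptimalAnticode.bStar d) := by
  open OptimalAnticode in
  refine ⟨isLeast_bStar hd, ?_⟩
  obtain ⟨x, hx, rfl⟩ := exists_of_mem_Opt hA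
  have hsort : Iso (blockMatrix d x) (blockMatrix d (x ∘ Tuple.sort x)) :=
    ⟨(Tuple.sort x)⁻¹, 1, by ext i j; simp [blockMatrix]⟩
  obtain ⟨D⟩ := nonempty_decomposition hd n _ (hx.comp_perm (Tuple.sort x))
    (Tuple.monotone_sort x)
  have hcard := D.card_ne_le hd (hx.comp_perm (Tuple.sort x))
  let p := (Fintype.equivFin {j // D.m j = d}).symm
  let q := (Fintype.equivFin {j // D.m j ≠ d}).symm
  refine ⟨Fintype.card {j // D.m j = d}, Fintype.card {j // D.m j ≠ d}, fun i => D.m (q i),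
    fun i => blockMatrix d (D.X (q i)), ?_, ?_, ?_⟩
  · rw [Fintype.card_subtype]
    exact hcard
  · exact hsort.trans (D.iso.trans (iso_onesSum (fun j => blockMatrix d (D.X j)) p q
      fun j hj => blockMatrix_eq_one (D.optimal j).1 hj))
  · intro i
    have ho := D.optimal (q i)
    exact ⟨bipGraph_connected_of_noCut (D.pos _) (D.monotone _) (ho.count_pos hd) (D.noCut _),
      (blockMatrix_mem_Opt_iff ho.1).2 ho,
      le_bStar_of_noCut hd (D.pos _) ho (D.monotone _) (D.noCut _)⟩
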